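/- Let $\omega\in\mathbb C\setminus\{0\}$. Let $U_q(h)$ be the unital associative $\mathbb C$-algebra generated by $A,A^\dagger,N,H$ and the exponentials $e^{\pm\omega H/4}$ (mutually inverse elements; powers of $e^{\omega H/4}$ are written $e^{m\omega H/4}$, $m\in\mathbb Z$) with relations $$[A,A^\dagger]=[H]:=\tfrac1\omega\big(e^{\omega H/2}-e^{-\omega H/2}\big),\qquad [N,A]=-A,\qquad [N,A^\dagger]=A^\dagger,\qquad H,\ e^{\pm\omega H/4}\ \text{central}.$$ Its Hopf algebra structure is $\Delta A=e^{-\omega H/4}\otimes A+A\otimes e^{\omega H/4}$, $\Delta A^\dagger=e^{-\omega H/4}\otimes A^\dagger+A^\dagger\otimes e^{\omega H/4}$, $N,H$ primitive, $e^{\pm\omega H/4}$ grouplike, $\varepsilon(X)=0$ and $S(X)=-X$ for $X=A,A^\dagger,N,H$, and its universal $R$-matrix is $$\mathcal R=e^{-\frac{\omega}{2}(H\otimes N+N\otimes H)}\,e^{\omega\, e^{\omega H/4}A\otimes e^{-\omega H/4}A^\dagger}=\sum\mathcal R^{(1)}\otimes\mathcal R^{(2)}.$$ Let $BU_q(h)$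 be the algebra $U_q(h)$ regarded as a $U_q(h)$-module algebra under the adjoint action $h\triangleright a=h_{(1)}\,a\,S(h_{(2)})$. For $U_q(h)$-module algebras $V,W$ on which $H$ acts by zero, $e^{\omega H/4}$ as the identity and $A$ locally nilpotently (so that the exponentials in $\mathcal R$ act on tensor products by finite sums), let $\Psi(v\otimes w)=\sum \mathcal R^{(2)}\triangleright w\otimes\mathcal R^{(1)}\triangleright v$ be the braiding, and let $V\,\underline\otimes\,W$ be the space $V\otimes W$ with the product $(a\otimes b)(c\otimes d)=a\,\Psi(b\otimes c)\,d$ and with the action given by $\Delta$; it is again such a module algebra. Iterating gives the $n$-fold braided tensor product algebra $BU_q(h)^{\underline\otimes n}$, $n\ge 0$ (for $n=0$ it is $\mathbb C$). For $Y\in U_q(h)$ and $1\le i\le n$ let $Y_i\in U_q(h)^{\otimes n}$ and $\bar Y_i\in BU_q(h)^{\underline\otimes n}$ be the elements with $Y$ in the $i$-th place and $1$ elsewhere. In $BU_q(h)^{\underline\otimes n}$ put $$\bar X_i=e^{-\frac{\omega}{2}\sum_{k<i}\bar H_k}\,\bar A_i,$$ $$\bar X^\dagger_i=e^{\frac{\omega}{2}\sum_{k<i}\bar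 H_k}\,\bar A^\dagger_i-\omega\,[\bar H_i]\,e^{-\frac{\omega}{4}\bar H_i}\sum_{j<i}e^{\frac{\omega}{2}\sum_{k<j}\bar H_k}\,e^{\frac{\omega}{4}\bar H_j}\,e^{-\frac{\omega}{2}\sum_{j<k<i}\bar H_k}\,\bar A^\dagger_j,$$ $$\bar M_i=\bar N_i-\omega\,e^{-\frac{\omega}{4}\bar H_i}\sum_{j<i}e^{-\frac{\omega}{4}\bar H_j}\,e^{-\omega\sum_{j<k<i}\bar H_k}\,\bar A^\dagger_j\bar A_i .$$ Then $[\bar H_i](\bar M_i-\bar N_i)=\bar X^\dagger_i\bar X_i-\bar A^\dagger_i\bar A_i$ for all $i$ (that is, $\bar M_i=\bar N_i+\frac{1}{[\bar H_i]}\{\bar X^\dagger_i\bar X_i-\bar A^\dagger_i\bar A_i\}$), and there is a unique isomorphism of $\mathbb C$-algebras $$\varphi:\ BU_q(h)^{\underline\otimes n}\ \xrightarrow{\ \sim\ }\ U_q(h)^{\otimes n}$$ onto the ordinary tensor product algebra such that, for all $1\le i\le n$, $$\varphi(\bar X_i)=A_i,\qquad \varphi(\bar X^\dagger_i)=A^\dagger_i,\qquad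 \varphi(\bar H_i)=H_i,\qquad \varphi\big(e^{\omega\bar H_i/4}\big)=e^{\omega H_i/4},\qquad \varphi(\bar M_i)=N_i .$$ -/

import Mathlib

open scoped TensorProduct

noncomputable section

namespace BraidedHeisenberg

/-- The generators `A`, `A†`, `N`, `H` of `U_q(h)` together with the exponentials
`K = e^{ωH/4}` and `K⁻¹ = e^{-ωH/4}`. For `ω ≠ 0` the functions `h` and `e^{ωh/4}` of a complex
variable `h` are algebraically independent, so the exponentials are adjoined as a central
invertible grouplike element with no further relation to `H`. -/
inductive Gen
  | A | Ad | N | H | K | Kinv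

/-- The relations of `U_q(h)`: `[A, A†] = ω⁻¹ (e^{ωH/2} - e^{-ωH/2})`, `[N, A] = -A`,
`[N, A†] = A†`, and `H`, `e^{±ωH/4}` central. -/
inductive Rel (ω : ℂ) : FreeAlgebra ℂ Gen → FreeAlgebra ℂ Gen → Prop
  | A_Ad : Rel ω (.ι ℂ .A * .ι ℂ .Ad - .ι ℂ .Ad * .ι ℂ .A)
      (ω⁻¹ • (.ι ℂ .K ^ 2 - .ι ℂ .Kinv ^ 2))
  | N_A : Rel ω (.ι ℂ .N * .ι ℂ .A - .ι ℂ .A * .ι ℂ .N) (-.ι ℂ .A)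
  | N_Ad : Rel ω (.ι ℂ .N * .ι ℂ .Ad - .ι ℂ .Ad * .ι ℂ .N) (.ι ℂ .Ad)
  | H_central (g : Gen) : Rel ω (.ι ℂ .H * .ι ℂ g) (.ι ℂ g * .ι ℂ .H)
  | K_central (g : Gen) : Rel ω (.ι ℂ .K * .ι ℂ g) (.ι ℂ g * .ι ℂ .K)
  | K_Kinv : Rel ω (.ι ℂ .K * .ι ℂ .Kinv) 1
  | Kinv_K : Rel ω (.ι ℂ .Kinv * .ι ℂ .K) 1

/-- The algebra `U_q(h)`. -/
def Uq (ω : ℂ) : Type := RingQuot (Rel ω)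

namespace Uq

variable (ω : ℂ)

instance : Ring (Uq ω) := inferInstanceAs (Ring (RingQuot (Rel ω)))

instance : Algebra ℂ (Uq ω) := inferInstanceAs (Algebra ℂ (RingQuot (Rel ω)))

/-- The quotient map from the free algebra. -/
def mk : FreeAlgebra ℂ Gen →ₐ[ℂ] Uq ω := RingQuot.mkAlgHom ℂ (Rel ω)

theorem mk_rel {x y : FreeAlgebra ℂ Gen} (h : Rel ω x y) : mk ω x = mk ω y :=
  RingQuot.mkAlgHom_rel ℂ h

theorem mk_surjective : Function.Surjective (mk ω) := RingQuot.mkAlgHom_surjective ℂ (Rel ω)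

/-- The class of a generator in `U_q(h)`. -/
def gen (g : Gen) : Uq ω := mk ω (FreeAlgebra.ι ℂ g)

/-- The annihilation generator `A`. -/
abbrev A : Uq ω := gen ω .A

/-- The creation generator `A†`. -/
abbrev Ad : Uq ω := gen ω .Ad

/-- The generator `N`. -/
abbrev N : Uq ω := gen ω .N

/-- The generator `H`. -/
abbrev H : Uq ω := gen ω .H

theorem gen_K_mul_gen_Kinv : gen ω .K * gen ω .Kinv = 1 := by
  have := mk_rel ω (Rel.K_Kinv (ω := ω))
  simpa [gen] using this

theorem gen_Kinv_mul_gen_K : gen ω .Kinv * gen ω .K = 1 := by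
  have := mk_rel ω (Rel.Kinv_K (ω := ω))
  simpa [gen] using this

/-- The invertible element `K = e^{ωH/4}`, so that `K ^ m` is `e^{mωH/4}` for every integer `m`. -/
def K : (Uq ω)ˣ where
  val := gen ω .K
  inv := gen ω .Kinv
  val_inv := gen_K_mul_gen_Kinv ω
  inv_val := gen_Kinv_mul_gen_K ω

/-- `[H] = ω⁻¹ (e^{ωH/2} - e^{-ωH/2})`. -/
def brH : Uq ω := ω⁻¹ • (((K ω ^ 2 : (Uq ω)ˣ) : Uq ω) - ((K ω ^ (-2 : ℤ) : (Uq ω)ˣ) : Uq ω))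

variable {ω}

theorem A_mul_Ad : A ω * Ad ω = Ad ω * A ω + brH ω := by
  have := mk_rel ω (Rel.A_Ad (ω := ω))
  simp only [map_sub, map_mul, map_smul, map_pow] at this
  rw [← sub_eq_iff_eq_add', brH]
  refine this.trans ?_
  congr 2

theorem N_mul_A : N ω * A ω = A ω * N ω - A ω := by
  have := mk_rel ω (Rel.N_A (ω := ω))
  simp only [map_sub, map_mul, map_neg] at this
  rw [sub_eq_add_neg, ← sub_eq_iff_eq_add']
  exact this

theorem N_mul_Ad : N ω * Ad ω = Ad ω * N ω + Ad ω := by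
  have := mk_rel ω (Rel.N_Ad (ω := ω))
  simp only [map_sub, map_mul] at this
  rw [← sub_eq_iff_eq_add']
  exact this

theorem gen_induction {p : Uq ω → Prop} (hg : ∀ g, p (gen ω g))
    (hc : ∀ c : ℂ, p (algebraMap ℂ (Uq ω) c)) (ha : ∀ x y, p x → p y → p (x + y))
    (hm : ∀ x y, p x → p y → p (x * y)) (x : Uq ω) : p x := by
  obtain ⟨y, rfl⟩ := mk_surjective ω x
  induction y using FreeAlgebra.induction with
  | grade0 r =>
    rw [AlgHom.commutes]
    exact hc r
  | grade1 g => exact hg g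
  | mul a b iha ihb => rw [map_mul]; exact hm _ _ iha ihb
  | add a b iha ihb => rw [map_add]; exact ha _ _ iha ihb

theorem H_comm (x : Uq ω) : H ω * x = x * H ω := by
  induction x using gen_induction with
  | hg g =>
    have := mk_rel ω (Rel.H_central (ω := ω) g)
    rw [map_mul, map_mul] at this
    exact this
  | hc c => exact (Algebra.commutes c _).symm
  | ha x y hx hy => rw [mul_add, add_mul, hx, hy]
  | hm x y hx hy => rw [← mul_assoc, hx, mul_assoc, hy, mul_assoc]

theorem K_comm (x : Uq ω) : (K ω : Uq ω) * x = x * K ω := by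
  induction x using gen_induction with
  | hg g =>
    have := mk_rel ω (Rel.K_central (ω := ω) g)
    rw [map_mul, map_mul] at this
    exact this
  | hc c => exact (Algebra.commutes c _).symm
  | ha x y hx hy => rw [mul_add, add_mul, hx, hy]
  | hm x y hx hy => rw [← mul_assoc, hx, mul_assoc, hy, mul_assoc]

theorem Kinv_comm (x : Uq ω) : ((K ω)⁻¹ : (Uq ω)ˣ) * x = x * ((K ω)⁻¹ : (Uq ω)ˣ) := by
  have h : Commute ((K ω : (Uq ω)ˣ) : Uq ω) x := K_comm x
  exact h.units_inv_left

/-- A family of elements of an algebra satisfying the relations of `U_q(h)` defines an algebra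
homomorphism out of `U_q(h)`. -/
def lift {B : Type*} [Ring B] [Algebra ℂ B] (f : Gen → B)
    (hA : f .A * f .Ad = f .Ad * f .A + ω⁻¹ • (f .K ^ 2 - f .Kinv ^ 2))
    (hNA : f .N * f .A = f .A * f .N - f .A) (hNAd : f .N * f .Ad = f .Ad * f .N + f .Ad)
    (hH : ∀ g, f .H * f g = f g * f .H) (hK : ∀ g, f .K * f g = f g * f .K)
    (h₁ : f .K * f .Kinv = 1) (h₂ : f .Kinv * f .K = 1) : Uq ω →ₐ[ℂ] B :=
  RingQuot.liftAlgHom ℂ ⟨FreeAlgebra.lift ℂ f, by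
    intro x y h
    cases h <;>
      simp only [map_sub, map_mul, map_smul, map_pow, map_neg, map_one, FreeAlgebra.lift_ι_apply]
    · rw [hA]; abel
    · rw [hNA]; abel
    · rw [hNAd]; abel
    · exact hH _
    · exact hK _
    · exact h₁
    · exact h₂⟩

theorem lift_gen {B : Type*} [Ring B] [Algebra ℂ B] (f : Gen → B) (hA hNA hNAd hH hK h₁ h₂)
    (g : Gen) : lift (ω := ω) f hA hNA hNAd hH hK h₁ h₂ (gen ω g) = f g := by
  refine (RingQuot.liftAlgHom_mkAlgHom_apply ℂ _ _ _).trans ?_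
  simp


theorem gen_K : gen ω .K = K ω := rfl

theorem gen_Kinv : gen ω .Kinv = ((K ω)⁻¹ : (Uq ω)ˣ) := rfl

theorem brH_eq : brH ω = ω⁻¹ • (gen ω .K ^ 2 - gen ω .Kinv ^ 2) := rfl

variable (ω)

/-- The coproduct on generators: `Δ A = e^{-ωH/4} ⊗ A + A ⊗ e^{ωH/4}`,
`Δ A† = e^{-ωH/4} ⊗ A† + A† ⊗ e^{ωH/4}`, `N` and `H` primitive, `e^{±ωH/4}` grouplike. -/
def comulGen : Gen → Uq ω ⊗[ℂ] Uq ω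
  | .A => gen ω .Kinv ⊗ₜ A ω + A ω ⊗ₜ gen ω .K
  | .Ad => gen ω .Kinv ⊗ₜ Ad ω + Ad ω ⊗ₜ gen ω .K
  | .N => N ω ⊗ₜ 1 + 1 ⊗ₜ N ω
  | .H => H ω ⊗ₜ 1 + 1 ⊗ₜ H ω
  | .K => gen ω .K ⊗ₜ gen ω .K
  | .Kinv => gen ω .Kinv ⊗ₜ gen ω .Kinv

/-- The coproduct `Δ` of `U_q(h)`. -/
def comul : Uq ω →ₐ[ℂ] Uq ω ⊗[ℂ] Uq ω :=
  lift (comulGen ω)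
    (by
      simp only [comulGen, mul_add, add_mul, Algebra.TensorProduct.tmul_mul_tmul, pow_two,
        A_mul_Ad, TensorProduct.tmul_add, TensorProduct.add_tmul, brH_eq, gen_Kinv, gen_K,
        K_comm (A ω), K_comm (Ad ω), Kinv_comm (A ω), Kinv_comm (Ad ω),
        TensorProduct.tmul_smul, ← TensorProduct.smul_tmul', TensorProduct.tmul_sub,
        TensorProduct.sub_tmul, smul_sub]
      abel)
    (by
      simp only [comulGen, mul_add, add_mul, Algebra.TensorProduct.tmul_mul_tmul,
        N_mul_A, TensorProduct.tmul_sub, TensorProduct.sub_tmul, gen_Kinv, gen_K, one_mul, mul_one,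
        K_comm (N ω), Kinv_comm (N ω)]
      abel)
    (by
      simp only [comulGen, mul_add, add_mul, Algebra.TensorProduct.tmul_mul_tmul,
        N_mul_Ad, TensorProduct.tmul_add, TensorProduct.add_tmul, gen_Kinv, gen_K, one_mul,
        mul_one, K_comm (N ω), Kinv_comm (N ω)]
      abel)
    (by
      intro g
      cases g <;>
      simp only [comulGen, mul_add, add_mul, Algebra.TensorProduct.tmul_mul_tmul, one_mul,
        mul_one, H_comm (A ω), H_comm (Ad ω), H_comm (N ω), H_comm (gen ω .K),
        H_comm (gen ω .Kinv)] <;> abel)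
    (by
      intro g
      cases g <;>
      simp only [comulGen, mul_add, add_mul, Algebra.TensorProduct.tmul_mul_tmul, one_mul,
        mul_one, gen_K, K_comm (A ω), K_comm (Ad ω), K_comm (N ω), K_comm (H ω),
        K_comm (gen ω .Kinv)])
    (by
      simp only [comulGen, Algebra.TensorProduct.tmul_mul_tmul, gen_K_mul_gen_Kinv,
        Algebra.TensorProduct.one_def])
    (by
      simp only [comulGen, Algebra.TensorProduct.tmul_mul_tmul, gen_Kinv_mul_gen_K,
        Algebra.TensorProduct.one_def])

theorem comul_gen (g : Gen) : comul ω (gen ω g) = comulGen ω g := lift_gen _ _ _ _ _ _ _ _ _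

/-- The counit on generators. -/
def counitGen : Gen → ℂ
  | .A | .Ad | .N | .H => 0
  | .K | .Kinv => 1

/-- The counit `ε` of `U_q(h)`. -/
def counit : Uq ω →ₐ[ℂ] ℂ :=
  lift counitGen (by simp [counitGen]) (by simp [counitGen]) (by simp [counitGen])
    (fun _ => mul_comm _ _) (fun _ => mul_comm _ _) (by simp [counitGen]) (by simp [counitGen])

theorem counit_gen (g : Gen) : counit ω (gen ω g) = counitGen g := lift_gen _ _ _ _ _ _ _ _ _

/-- The antipode on generators: `S X = -X` for `X = A, A†, N, H`, and `S e^{±ωH/4} = e^{∓ωH/4}`. -/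
def antipodeGen : Gen → (Uq ω)ᵐᵒᵖ
  | .A => .op (-A ω)
  | .Ad => .op (-Ad ω)
  | .N => .op (-N ω)
  | .H => .op (-H ω)
  | .K => .op (gen ω .Kinv)
  | .Kinv => .op (gen ω .K)

/-- The antipode `S` of `U_q(h)`, as an algebra homomorphism to the opposite algebra. -/
def antipode : Uq ω →ₐ[ℂ] (Uq ω)ᵐᵒᵖ :=
  lift (antipodeGen ω)
    (by
      simp only [antipodeGen, ← MulOpposite.op_mul, neg_mul_neg, A_mul_Ad, brH_eq,
        ← MulOpposite.op_pow, ← MulOpposite.op_sub, ← MulOpposite.op_smul, ← MulOpposite.op_add,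
        smul_sub]
      congr 1
      abel)
    (by
      simp only [antipodeGen, ← MulOpposite.op_mul, neg_mul_neg, N_mul_A, ← MulOpposite.op_sub]
      congr 1
      abel)
    (by
      simp only [antipodeGen, ← MulOpposite.op_mul, neg_mul_neg, N_mul_Ad, ← MulOpposite.op_add]
      congr 1
      abel)
    (by
      intro g
      cases g <;>
      simp only [antipodeGen, ← MulOpposite.op_mul, neg_mul, mul_neg, H_comm (A ω),
        H_comm (Ad ω), H_comm (N ω), H_comm (gen ω .K), H_comm (gen ω .Kinv)])
    (by
      intro g
      cases g <;>
      simp only [antipodeGen, ← MulOpposite.op_mul, neg_mul, mul_neg, gen_Kinv, gen_K,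
        Kinv_comm (A ω), Kinv_comm (Ad ω), Kinv_comm (N ω), Kinv_comm (H ω), Kinv_comm (K ω : Uq ω)])
    (by simp only [antipodeGen, ← MulOpposite.op_mul, gen_K_mul_gen_Kinv, MulOpposite.op_one])
    (by simp only [antipodeGen, ← MulOpposite.op_mul, gen_Kinv_mul_gen_K, MulOpposite.op_one])

theorem antipode_gen (g : Gen) : antipode ω (gen ω g) = antipodeGen ω g :=
  lift_gen _ _ _ _ _ _ _ _ _

/-- The quantum adjoint action `h ▷ a = h₍₁₎ a S(h₍₂₎)` of `U_q(h)` on itself. -/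
def adjoint : Uq ω →ₐ[ℂ] Module.End ℂ (Uq ω) :=
  (AlgHom.mulLeftRight ℂ (Uq ω)).comp
    ((Algebra.TensorProduct.map (AlgHom.id ℂ (Uq ω)) (antipode ω)).comp (comul ω))

theorem adjoint_A (x : Uq ω) : adjoint ω (A ω) x = gen ω .Kinv * (A ω * x - x * A ω) := by
  simp only [adjoint, AlgHom.comp_apply, comul_gen, comulGen, map_add,
    Algebra.TensorProduct.map_tmul, antipode_gen, antipodeGen, LinearMap.add_apply,
    AlgHom.mulLeftRight_apply, AlgHom.id_apply, MulOpposite.unop_op]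
  rw [gen_Kinv, ← Kinv_comm (A ω * x)]
  noncomm_ring

theorem adjoint_Ad (x : Uq ω) : adjoint ω (Ad ω) x = gen ω .Kinv * (Ad ω * x - x * Ad ω) := by
  simp only [adjoint, AlgHom.comp_apply, comul_gen, comulGen, map_add,
    Algebra.TensorProduct.map_tmul, antipode_gen, antipodeGen, LinearMap.add_apply,
    AlgHom.mulLeftRight_apply, AlgHom.id_apply, MulOpposite.unop_op]
  rw [gen_Kinv, ← Kinv_comm (Ad ω * x)]
  noncomm_ring

theorem adjoint_N (x : Uq ω) : adjoint ω (N ω) x = N ω * x - x * N ω := by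
  simp only [adjoint, AlgHom.comp_apply, comul_gen, comulGen, map_add,
    Algebra.TensorProduct.map_tmul, antipode_gen, antipodeGen, LinearMap.add_apply,
    AlgHom.mulLeftRight_apply, AlgHom.id_apply, MulOpposite.unop_op, map_one, MulOpposite.unop_one]
  noncomm_ring

theorem adjoint_H : adjoint ω (H ω) = 0 := by
  ext x
  simp only [adjoint, AlgHom.comp_apply, comul_gen, comulGen, map_add,
    Algebra.TensorProduct.map_tmul, antipode_gen, antipodeGen, LinearMap.add_apply,
    AlgHom.mulLeftRight_apply, AlgHom.id_apply, MulOpposite.unop_op, map_one, MulOpposite.unop_one]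
  rw [H_comm, LinearMap.zero_apply]
  noncomm_ring

theorem adjoint_K : adjoint ω (gen ω .K) = 1 := by
  ext x
  simp only [adjoint, AlgHom.comp_apply, comul_gen, comulGen,
    Algebra.TensorProduct.map_tmul, antipode_gen, antipodeGen,
    AlgHom.mulLeftRight_apply, AlgHom.id_apply, MulOpposite.unop_op, Module.End.one_apply]
  rw [gen_K, K_comm, mul_assoc, ← gen_K, gen_K_mul_gen_Kinv, mul_one]

end Uq

/-- The action of `U_q(h)` on a tensor product of two modules, `h ▷ (v ⊗ w) = h₍₁₎ ▷ v ⊗ h₍₂₎ ▷ w`. -/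
def tensorAct {ω : ℂ} {V W : Type*} [AddCommGroup V] [Module ℂ V] [AddCommGroup W] [Module ℂ W]
    (f : Uq ω →ₐ[ℂ] Module.End ℂ V) (g : Uq ω →ₐ[ℂ] Module.End ℂ W) :
    Uq ω →ₐ[ℂ] Module.End ℂ (V ⊗[ℂ] W) :=
  (Module.endTensorEndAlgHom (R := ℂ) (S := ℂ) (A := ℂ) (M := V) (N := W)).comp
    ((Algebra.TensorProduct.map f g).comp (Uq.comul ω))

/-- A locally nilpotent operator. -/
def LocNil {V : Type*} [AddCommGroup V] [Module ℂ V] (T : Module.End ℂ V) : Prop :=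
  ∀ v, ∃ n : ℕ, (T ^ n) v = 0

section LocNil

variable {V W : Type*} [AddCommGroup V] [Module ℂ V] [AddCommGroup W] [Module ℂ W]

theorem pow_apply_eq_zero_of_le {T : Module.End ℂ V} {v : V} {m n : ℕ} (hmn : m ≤ n)
    (h : (T ^ m) v = 0) : (T ^ n) v = 0 := by
  obtain ⟨k, rfl⟩ := Nat.exists_eq_add_of_le hmn
  rw [add_comm, pow_add, Module.End.mul_apply, h, map_zero]

theorem finsum_exp_eq {T : Module.End ℂ V} {v : V} {n : ℕ} (h : (T ^ n) v = 0) :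
    ∑ᶠ k : ℕ, ((k.factorial : ℂ)⁻¹ • (T ^ k) v)
      = ∑ k ∈ Finset.range n, ((k.factorial : ℂ)⁻¹ • (T ^ k) v) := by
  apply finsum_eq_sum_of_support_subset
  intro k hk
  simp only [Finset.coe_range, Set.mem_Iio]
  by_contra hkn
  exact hk (by simp [pow_apply_eq_zero_of_le (not_lt.1 hkn) h])

/-- The exponential `exp T = ∑ₖ Tᵏ / k!` of a locally nilpotent operator: for each vector only
finitely many terms of the sum are non-zero. -/
def locExp (T : Module.End ℂ V) (hT : LocNil T) : Module.End ℂ V where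
  toFun v := ∑ᶠ k : ℕ, ((k.factorial : ℂ)⁻¹ • (T ^ k) v)
  map_add' x y := by
    obtain ⟨m, hm⟩ := hT x
    obtain ⟨n, hn⟩ := hT y
    have hm' := pow_apply_eq_zero_of_le (le_max_left m n) hm
    have hn' := pow_apply_eq_zero_of_le (le_max_right m n) hn
    rw [finsum_exp_eq hm', finsum_exp_eq hn', finsum_exp_eq (n := max m n) (by simp [hm', hn']),
      ← Finset.sum_add_distrib]
    simp
  map_smul' c x := by
    obtain ⟨m, hm⟩ := hT x
    rw [finsum_exp_eq hm, finsum_exp_eq (n := m) (by simp [hm]), Finset.smul_sum]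
    simp [smul_comm c]

theorem locExp_apply {T : Module.End ℂ V} (hT : LocNil T) {v : V} {n : ℕ} (h : (T ^ n) v = 0) :
    locExp T hT v = ∑ k ∈ Finset.range n, ((k.factorial : ℂ)⁻¹ • (T ^ k) v) := finsum_exp_eq h

theorem locNil_zero : LocNil (0 : Module.End ℂ V) := fun v => ⟨1, by simp⟩

theorem locExp_eq_one {T : Module.End ℂ V} (hT : LocNil T) (h : T = 0) : locExp T hT = 1 := by
  ext v
  rw [locExp_apply hT (n := 1) (by simp [h])]
  simp

theorem locExp_comm {T P : Module.End ℂ V} (hT : LocNil T) (h : P * T = T * P) :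
    P * locExp T hT = locExp T hT * P := by
  ext v
  have hk : ∀ k, P ((T ^ k) v) = (T ^ k) (P v) := fun k =>
    congrArg (fun S : Module.End ℂ V => S v) ((show Commute P T from h).pow_right k)
  obtain ⟨n, hn⟩ := hT v
  rw [Module.End.mul_apply, Module.End.mul_apply, locExp_apply hT hn,
    locExp_apply hT (n := n) (by rw [← hk, hn, map_zero])]
  simp [hk]

theorem LocNil.of_tmul {T : Module.End ℂ (V ⊗[ℂ] W)}
    (h : ∀ v w, ∃ n : ℕ, (T ^ n) (v ⊗ₜ w) = 0) : LocNil T := by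
  intro t
  induction t with
  | zero => exact ⟨0, by simp⟩
  | tmul v w => exact h v w
  | add x y hx hy =>
    obtain ⟨m, hm⟩ := hx
    obtain ⟨n, hn⟩ := hy
    exact ⟨max m n, by simp [pow_apply_eq_zero_of_le (le_max_left m n) hm,
      pow_apply_eq_zero_of_le (le_max_right m n) hn]⟩

theorem LocNil.smul_map {S : Module.End ℂ V} (hS : LocNil S) (c : ℂ) (T : Module.End ℂ W) :
    LocNil (c • TensorProduct.map S T) := by
  refine LocNil.of_tmul fun v w => ?_
  obtain ⟨n, hn⟩ := hS v
  exact ⟨n, by rw [smul_pow, TensorProduct.map_pow]; simp [hn]⟩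

theorem LocNil.sum_map {S : Module.End ℂ V} (hS : LocNil S) {T : Module.End ℂ W} (hT : LocNil T) :
    LocNil (TensorProduct.map 1 T + TensorProduct.map S 1) := by
  refine LocNil.of_tmul fun v w => ?_
  obtain ⟨m, hm⟩ := hS v
  obtain ⟨n, hn⟩ := hT w
  refine ⟨m + n, ?_⟩
  have hc : Commute (TensorProduct.map (1 : Module.End ℂ V) T)
      (TensorProduct.map S (1 : Module.End ℂ W)) := by
    rw [Commute, SemiconjBy, ← TensorProduct.map_mul, ← TensorProduct.map_mul]
    simp
  rw [hc.add_pow', LinearMap.sum_apply]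
  refine Finset.sum_eq_zero fun p hp => ?_
  rw [TensorProduct.map_pow, TensorProduct.map_pow, ← TensorProduct.map_mul]
  simp only [one_pow, mul_one, one_mul, LinearMap.smul_apply, TensorProduct.map_tmul]
  rw [Finset.HasAntidiagonal.mem_antidiagonal] at hp
  rcases le_or_gt m p.2 with h | h
  · rw [pow_apply_eq_zero_of_le h hm]; simp
  · rw [pow_apply_eq_zero_of_le (show n ≤ p.1 by omega) hn]; simp

end LocNil

/-- An algebra in the braided category of `U_q(h)`-modules, among the modules on which `H` acts by
zero (so `e^{ωH/4}` acts as the identity) and `A` acts locally nilpotently. On tensor products of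
such modules the exponential series in the universal `R`-matrix are finite sums. -/
structure ModAlg (ω : ℂ) where
  /-- The underlying algebra. -/
  carrier : Type
  [ring : Ring carrier]
  [algebra : Algebra ℂ carrier]
  /-- The action `h ▷ x`. -/
  act : Uq ω →ₐ[ℂ] Module.End ℂ carrier
  act_one : ∀ h, act h 1 = Uq.counit ω h • (1 : carrier)
  act_mul : ∀ h t, act h (LinearMap.mul' ℂ carrier t)
    = LinearMap.mul' ℂ carrier (tensorAct act act h t)
  act_H : act (Uq.H ω) = 0
  act_K : act (Uq.K ω) = 1
  act_A_locNil : LocNil (act (Uq.A ω))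

attribute [instance] ModAlg.ring ModAlg.algebra

namespace ModAlg

variable {ω : ℂ} (X Y : ModAlg ω)

theorem act_gen_K : X.act (Uq.gen ω .K) = 1 := X.act_K

theorem act_gen_Kinv : X.act (Uq.gen ω .Kinv) = 1 := by
  have h := congrArg X.act (Uq.gen_K_mul_gen_Kinv ω)
  rwa [map_mul, act_gen_K, one_mul, map_one] at h

theorem act_A_comm_act_Ad :
    X.act (Uq.A ω) * X.act (Uq.Ad ω) = X.act (Uq.Ad ω) * X.act (Uq.A ω) := by
  rw [← map_mul, ← map_mul, Uq.A_mul_Ad, map_add, Uq.brH_eq, map_smul, map_sub, map_pow, map_pow,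
    act_gen_K, act_gen_Kinv]
  simp

theorem tensorAct_apply {h : Uq ω} {s : Uq ω ⊗[ℂ] Uq ω} (hs : Uq.comul ω h = s) :
    tensorAct X.act Y.act h = Module.endTensorEndAlgHom (R := ℂ) (S := ℂ) (A := ℂ)
      (Algebra.TensorProduct.map X.act Y.act s) := by
  rw [← hs]; rfl

theorem end_tmul {V W : Type*} [AddCommGroup V] [Module ℂ V] [AddCommGroup W] [Module ℂ W]
    (f : Module.End ℂ V) (g : Module.End ℂ W) :
    Module.endTensorEndAlgHom (R := ℂ) (S := ℂ) (A := ℂ) (f ⊗ₜ[ℂ] g) = TensorProduct.map f g := rfl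

theorem tensorAct_A : tensorAct X.act Y.act (Uq.A ω)
    = TensorProduct.map 1 (Y.act (Uq.A ω)) + TensorProduct.map (X.act (Uq.A ω)) 1 := by
  rw [tensorAct_apply X Y (Uq.comul_gen ω .A)]
  simp only [Uq.comulGen, map_add, Algebra.TensorProduct.map_tmul, end_tmul, act_gen_K,
    act_gen_Kinv]

theorem tensorAct_Ad : tensorAct X.act Y.act (Uq.Ad ω)
    = TensorProduct.map 1 (Y.act (Uq.Ad ω)) + TensorProduct.map (X.act (Uq.Ad ω)) 1 := by
  rw [tensorAct_apply X Y (Uq.comul_gen ω .Ad)]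
  simp only [Uq.comulGen, map_add, Algebra.TensorProduct.map_tmul, end_tmul, act_gen_K,
    act_gen_Kinv]

theorem tensorAct_N : tensorAct X.act Y.act (Uq.N ω)
    = TensorProduct.map 1 (Y.act (Uq.N ω)) + TensorProduct.map (X.act (Uq.N ω)) 1 := by
  rw [tensorAct_apply X Y (Uq.comul_gen ω .N)]
  simp only [Uq.comulGen, map_add, Algebra.TensorProduct.map_tmul, end_tmul, map_one]
  exact add_comm _ _

theorem tensorAct_H : tensorAct X.act Y.act (Uq.H ω) = 0 := by
  rw [tensorAct_apply X Y (Uq.comul_gen ω .H)]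
  simp only [Uq.comulGen, map_add, Algebra.TensorProduct.map_tmul, end_tmul, act_H,
    TensorProduct.map_zero_left, TensorProduct.map_zero_right, add_zero]

theorem tensorAct_gen_K : tensorAct X.act Y.act (Uq.gen ω .K) = 1 := by
  rw [tensorAct_apply X Y (Uq.comul_gen ω .K)]
  simp only [Uq.comulGen, Algebra.TensorProduct.map_tmul, end_tmul, act_gen_K,
    TensorProduct.map_one]

theorem tensorAct_gen_Kinv : tensorAct X.act Y.act (Uq.gen ω .Kinv) = 1 := by
  rw [tensorAct_apply X Y (Uq.comul_gen ω .Kinv)]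
  simp only [Uq.comulGen, Algebra.TensorProduct.map_tmul, end_tmul, act_gen_Kinv,
    TensorProduct.map_one]

/-- `A`, `A†` and `N` act as derivations. -/
theorem act_leibniz {h : Uq ω} (hh : tensorAct X.act X.act h
    = TensorProduct.map 1 (X.act h) + TensorProduct.map (X.act h) 1) (x y : X.carrier) :
    X.act h (x * y) = x * X.act h y + X.act h x * y := by
  simpa [hh] using X.act_mul h (x ⊗ₜ y)

/-- The exponent `-ω/2 (H ⊗ N + N ⊗ H)` of the universal `R`-matrix, acting on `X ⊗ Y`. -/
def exponentHN : Module.End ℂ (X.carrier ⊗[ℂ] Y.carrier) :=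
  (-ω / 2) • (TensorProduct.map (X.act (Uq.H ω)) (Y.act (Uq.N ω))
    + TensorProduct.map (X.act (Uq.N ω)) (Y.act (Uq.H ω)))

/-- The exponent `ω e^{ωH/4} A ⊗ e^{-ωH/4} A†` of the universal `R`-matrix, acting on `X ⊗ Y`. -/
def exponentA : Module.End ℂ (X.carrier ⊗[ℂ] Y.carrier) :=
  ω • TensorProduct.map (X.act (Uq.K ω * Uq.A ω))
    (Y.act (((Uq.K ω)⁻¹ : (Uq ω)ˣ) * Uq.Ad ω))

theorem exponentHN_eq : exponentHN X Y = 0 := by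
  simp [exponentHN, act_H]

theorem exponentA_eq : exponentA X Y
    = ω • TensorProduct.map (X.act (Uq.A ω)) (Y.act (Uq.Ad ω)) := by
  rw [exponentA, map_mul, map_mul, act_K, ← Uq.gen_Kinv, act_gen_Kinv, one_mul, one_mul]

theorem exponentHN_locNil : LocNil (exponentHN X Y) := by
  rw [exponentHN_eq]; exact locNil_zero

theorem exponentA_locNil : LocNil (exponentA X Y) := by
  rw [exponentA_eq]; exact X.act_A_locNil.smul_map _ _

/-- The action on `X ⊗ Y` of the universal `R`-matrix
`ℛ = e^{-ω/2 (H ⊗ N + N ⊗ H)} e^{ω e^{ωH/4} A ⊗ e^{-ωH/4} A†}`. -/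
def rMatrix : Module.End ℂ (X.carrier ⊗[ℂ] Y.carrier) :=
  locExp (exponentHN X Y) (exponentHN_locNil X Y) * locExp (exponentA X Y) (exponentA_locNil X Y)

/-- The braiding `Ψ(v ⊗ w) = ℛ⁽²⁾ ▷ w ⊗ ℛ⁽¹⁾ ▷ v`. -/
def braiding : X.carrier ⊗[ℂ] Y.carrier →ₗ[ℂ] Y.carrier ⊗[ℂ] X.carrier :=
  (TensorProduct.comm ℂ X.carrier Y.carrier).toLinearMap ∘ₗ rMatrix X Y

theorem rMatrix_eq : rMatrix X Y = locExp (exponentA X Y) (exponentA_locNil X Y) := by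
  rw [rMatrix, locExp_eq_one _ (exponentHN_eq X Y), one_mul]

theorem braiding_tmul {x : X.carrier} {n : ℕ} (hn : (X.act (Uq.A ω) ^ n) x = 0) (y : Y.carrier) :
    braiding X Y (x ⊗ₜ y) = ∑ k ∈ Finset.range n, (ω ^ k * (k.factorial : ℂ)⁻¹) •
      ((Y.act (Uq.Ad ω) ^ k) y ⊗ₜ[ℂ] (X.act (Uq.A ω) ^ k) x) := by
  have hpow : ∀ k, (exponentA X Y ^ k) (x ⊗ₜ y)
      = ω ^ k • ((X.act (Uq.A ω) ^ k) x ⊗ₜ[ℂ] (Y.act (Uq.Ad ω) ^ k) y) := by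
    intro k
    rw [exponentA_eq, smul_pow, TensorProduct.map_pow]
    simp
  rw [braiding, LinearMap.comp_apply, rMatrix_eq, locExp_apply _ (n := n) (by simp [hpow, hn])]
  simp only [hpow, map_sum, map_smul, LinearEquiv.coe_coe, TensorProduct.comm_tmul, smul_smul]
  simp only [mul_comm]

theorem braiding_comm {h : Uq ω}
    (h₁ : Commute (tensorAct X.act Y.act h) (exponentA X Y))
    (h₂ : tensorAct X.act Y.act h
      = TensorProduct.map 1 (Y.act h) + TensorProduct.map (X.act h) 1)
    (h₃ : tensorAct Y.act X.act h
      = TensorProduct.map 1 (X.act h) + TensorProduct.map (Y.act h) 1)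
    (t : X.carrier ⊗[ℂ] Y.carrier) :
    braiding X Y (tensorAct X.act Y.act h t) = tensorAct Y.act X.act h (braiding X Y t) := by
  have e := congrArg (fun f => f t) (locExp_comm (exponentA_locNil X Y) h₁)
  simp only [Module.End.mul_apply] at e
  simp only [braiding, LinearMap.comp_apply, rMatrix_eq, LinearEquiv.coe_coe]
  rw [← e, h₂, h₃]
  generalize locExp _ _ t = s
  induction s with
  | zero => simp
  | tmul a b => simp [add_comm]
  | add a b ha hb => simp only [map_add, ha, hb]

/-- The underlying space of the braided tensor product of `X` and `Y`. -/
def BTensor : Type := X.carrier ⊗[ℂ] Y.carrier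

instance : AddCommGroup (BTensor X Y) :=
  inferInstanceAs (AddCommGroup (X.carrier ⊗[ℂ] Y.carrier))

instance : Module ℂ (BTensor X Y) :=
  inferInstanceAs (Module ℂ (X.carrier ⊗[ℂ] Y.carrier))

/-- The product `(a ⊗ b)(c ⊗ d) = a Ψ(b ⊗ c) d` of the braided tensor product, as the composite
`(· ⊗ ·) ∘ (id ⊗ Ψ ⊗ id)`. -/
def braidedMul : (X.carrier ⊗[ℂ] Y.carrier) ⊗[ℂ] (X.carrier ⊗[ℂ] Y.carrier) →ₗ[ℂ]
    X.carrier ⊗[ℂ] Y.carrier :=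
  TensorProduct.map (LinearMap.mul' ℂ X.carrier) (LinearMap.mul' ℂ Y.carrier)
    ∘ₗ (TensorProduct.assoc ℂ X.carrier X.carrier (Y.carrier ⊗[ℂ] Y.carrier)).symm.toLinearMap
    ∘ₗ LinearMap.lTensor X.carrier
        ((TensorProduct.assoc ℂ X.carrier Y.carrier Y.carrier).toLinearMap
          ∘ₗ LinearMap.rTensor Y.carrier (braiding Y X)
          ∘ₗ (TensorProduct.assoc ℂ Y.carrier X.carrier Y.carrier).symm.toLinearMap)
    ∘ₗ (TensorProduct.assoc ℂ X.carrier Y.carrier (X.carrier ⊗[ℂ] Y.carrier)).toLinearMap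

theorem braidedMul_tmul (a c : X.carrier) (b d : Y.carrier) :
    braidedMul X Y ((a ⊗ₜ b) ⊗ₜ (c ⊗ₜ d))
      = TensorProduct.map (LinearMap.mulLeft ℂ a) (LinearMap.mulRight ℂ d)
          (braiding Y X (b ⊗ₜ c)) := by
  simp only [braidedMul, LinearMap.comp_apply, LinearEquiv.coe_coe, TensorProduct.assoc_tmul,
    LinearMap.lTensor_tmul, TensorProduct.assoc_symm_tmul, LinearMap.rTensor_tmul]
  generalize braiding Y X (b ⊗ₜ c) = s
  induction s with
  | zero => simp
  | tmul x y => simp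
  | add x y hx hy => simp only [TensorProduct.add_tmul, TensorProduct.tmul_add, map_add, hx, hy]

theorem braidedMul_tmul_eq_sum (a c : X.carrier) {b : Y.carrier} (d : Y.carrier) {n : ℕ}
    (hn : (Y.act (Uq.A ω) ^ n) b = 0) :
    braidedMul X Y ((a ⊗ₜ b) ⊗ₜ (c ⊗ₜ d)) = ∑ k ∈ Finset.range n,
      (ω ^ k * (k.factorial : ℂ)⁻¹) •
        ((a * (X.act (Uq.Ad ω) ^ k) c) ⊗ₜ[ℂ] ((Y.act (Uq.A ω) ^ k) b * d)) := by
  rw [braidedMul_tmul, braiding_tmul Y X hn]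
  simp

theorem sum_antidiagonal_eq {V : Type*} [AddCommGroup V] {n : ℕ} (f : ℕ → ℕ → V)
    (h₁ : ∀ p q, n ≤ p → f p q = 0) (h₂ : ∀ p q, n ≤ q → f p q = 0) :
    ∑ l ∈ Finset.range (2 * n), ∑ x ∈ Finset.HasAntidiagonal.antidiagonal l, f x.1 x.2
      = ∑ p ∈ Finset.range n, ∑ q ∈ Finset.range n, f p q := by
  rw [← Finset.sum_product', ← Finset.sum_fiberwise_of_maps_to
    (s := Finset.range n ×ˢ Finset.range n) (t := Finset.range (2 * n)) (g := fun x => x.1 + x.2)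
    (by intro x hx; simp only [Finset.mem_product, Finset.mem_range] at hx ⊢; omega)]
  refine Finset.sum_congr rfl fun l _ => (Finset.sum_subset ?_ ?_).symm
  · intro x hx
    simp only [Finset.mem_filter] at hx
    simpa using hx.2
  · intro x hx hx'
    simp only [Finset.mem_filter, Finset.mem_product, Finset.mem_range, not_and] at hx'
    rw [Finset.HasAntidiagonal.mem_antidiagonal] at hx
    by_cases h : n ≤ x.1
    · exact h₁ _ _ h
    · by_cases h' : n ≤ x.2
      · exact h₂ _ _ h'
      · exact absurd hx (hx' ⟨not_le.1 h, not_le.1 h'⟩)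

theorem pow_leibniz {h : Uq ω} (hh : tensorAct X.act X.act h
    = TensorProduct.map 1 (X.act h) + TensorProduct.map (X.act h) 1) (l : ℕ) (x y : X.carrier) :
    (ω ^ l * (l.factorial : ℂ)⁻¹) • (X.act h ^ l) (x * y)
      = ∑ p ∈ Finset.HasAntidiagonal.antidiagonal l,
        ((ω ^ p.1 * (p.1.factorial : ℂ)⁻¹) * (ω ^ p.2 * (p.2.factorial : ℂ)⁻¹)) •
          ((X.act h ^ p.1) x * (X.act h ^ p.2) y) := by
  have hc : Commute (TensorProduct.map (X.act h) (1 : Module.End ℂ X.carrier))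
      (TensorProduct.map (1 : Module.End ℂ X.carrier) (X.act h)) := by
    rw [Commute, SemiconjBy, ← TensorProduct.map_mul, ← TensorProduct.map_mul]
    simp
  have e := X.act_mul (h ^ l) (x ⊗ₜ y)
  rw [map_pow, map_pow, hh, add_comm, hc.add_pow'] at e
  rw [LinearMap.mul'_apply] at e
  rw [e, LinearMap.sum_apply, map_sum, Finset.smul_sum]
  refine Finset.sum_congr rfl fun p hp => ?_
  rw [Finset.HasAntidiagonal.mem_antidiagonal] at hp
  rw [TensorProduct.map_pow, TensorProduct.map_pow, ← TensorProduct.map_mul]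
  simp only [one_pow, mul_one, one_mul, LinearMap.smul_apply, TensorProduct.map_tmul, map_nsmul,
    LinearMap.mul'_apply]
  rw [← Nat.cast_smul_eq_nsmul ℂ, smul_smul]
  congr 1
  have hl : p.1 ≤ l := by omega
  rw [Nat.cast_choose ℂ hl, show l - p.1 = p.2 by omega, ← hp, pow_add]
  have := Nat.cast_ne_zero (R := ℂ).2 (p.1 + p.2).factorial_ne_zero
  have := Nat.cast_ne_zero (R := ℂ).2 p.1.factorial_ne_zero
  have := Nat.cast_ne_zero (R := ℂ).2 p.2.factorial_ne_zero
  field_simp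

theorem pow_mul_eq_zero {V : Type*} [Ring V] [Algebra ℂ V] {D : Module.End ℂ V}
    (hD : ∀ x y, D (x * y) = x * D y + D x * y) {x y : V} {n : ℕ} (hx : (D ^ n) x = 0)
    (hy : (D ^ n) y = 0) : (D ^ (2 * n)) (x * y) = 0 := by
  have hc : Commute (TensorProduct.map (1 : Module.End ℂ V) D)
      (TensorProduct.map D (1 : Module.End ℂ V)) := by
    rw [Commute, SemiconjBy, ← TensorProduct.map_mul, ← TensorProduct.map_mul]
    simp
  let T : Module.End ℂ (V ⊗[ℂ] V) := TensorProduct.map 1 D + TensorProduct.map D 1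
  have hT : ∀ t : V ⊗[ℂ] V, D (LinearMap.mul' ℂ V t) = LinearMap.mul' ℂ V (T t) := by
    intro t
    induction t with
    | zero => simp
    | tmul u v => simp [hD, T]
    | add x y hx hy => simp only [map_add, hx, hy]
  have e : ∀ (l : ℕ) (t : V ⊗[ℂ] V), (D ^ l) (LinearMap.mul' ℂ V t)
      = LinearMap.mul' ℂ V ((T ^ l) t) := by
    intro l
    induction l with
    | zero => simp
    | succ l ih => intro t; rw [pow_succ, pow_succ, Module.End.mul_apply, hT, ih]; rfl
  rw [← LinearMap.mul'_apply (R := ℂ) (a := x), e, hc.add_pow', LinearMap.sum_apply, map_sum]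
  refine Finset.sum_eq_zero fun p hp => ?_
  rw [Finset.HasAntidiagonal.mem_antidiagonal] at hp
  rw [TensorProduct.map_pow, TensorProduct.map_pow, ← TensorProduct.map_mul]
  simp only [one_pow, mul_one, one_mul, LinearMap.smul_apply, TensorProduct.map_tmul]
  rcases le_or_gt n p.2 with h | h
  · rw [pow_apply_eq_zero_of_le h hx]; simp
  · rw [pow_apply_eq_zero_of_le (show n ≤ p.1 by omega) hy]; simp

theorem braidedMul_assoc (u v w : X.carrier ⊗[ℂ] Y.carrier) :
    braidedMul X Y (braidedMul X Y (u ⊗ₜ v) ⊗ₜ w)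
      = braidedMul X Y (u ⊗ₜ braidedMul X Y (v ⊗ₜ w)) := by
  induction u with
  | zero => simp
  | add u₁ u₂ h₁ h₂ => simp only [TensorProduct.add_tmul, map_add, h₁, h₂]
  | tmul a b =>
  induction v with
  | zero => simp
  | add u₁ u₂ h₁ h₂ => simp only [TensorProduct.add_tmul, TensorProduct.tmul_add, map_add, h₁, h₂]
  | tmul c d =>
  induction w with
  | zero => simp
  | add u₁ u₂ h₁ h₂ => simp only [TensorProduct.tmul_add, map_add, h₁, h₂]
  | tmul e f =>
  obtain ⟨m₁, hm₁⟩ := Y.act_A_locNil b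
  obtain ⟨m₂, hm₂⟩ := Y.act_A_locNil d
  set n := max m₁ m₂
  have hb : (Y.act (Uq.A ω) ^ n) b = 0 := pow_apply_eq_zero_of_le (le_max_left _ _) hm₁
  have hd : (Y.act (Uq.A ω) ^ n) d = 0 := pow_apply_eq_zero_of_le (le_max_right _ _) hm₂
  set D := Y.act (Uq.A ω) with hD
  set E := X.act (Uq.Ad ω) with hE
  let c' : ℕ → ℂ := fun k => ω ^ k * (k.factorial : ℂ)⁻¹
  have hzero : ∀ k, n ≤ k → (D ^ k) b = 0 := fun k hk => pow_apply_eq_zero_of_le hk hb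
  have hzero' : ∀ k, n ≤ k → (D ^ k) d = 0 := fun k hk => pow_apply_eq_zero_of_le hk hd
  -- the common value of both sides
  let F : ℕ → ℕ → ℕ → X.carrier ⊗[ℂ] Y.carrier := fun k p q =>
    (c' k * (c' p * c' q)) • ((a * (E ^ k) c * (E ^ (p + q)) e) ⊗ₜ[ℂ]
      ((D ^ (p + k)) b * (D ^ q) d * f))
  have hL : braidedMul X Y (braidedMul X Y ((a ⊗ₜ b) ⊗ₜ (c ⊗ₜ d)) ⊗ₜ (e ⊗ₜ f))
      = ∑ k ∈ Finset.range n, ∑ p ∈ Finset.range n, ∑ q ∈ Finset.range n, F k p q := by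
    rw [braidedMul_tmul_eq_sum X Y a c d hb, TensorProduct.sum_tmul, map_sum]
    refine Finset.sum_congr rfl fun k _ => ?_
    have hk : (D ^ n) ((D ^ k) b) = 0 := by
      rw [← Module.End.mul_apply, ← pow_add]; exact hzero _ (by omega)
    rw [← TensorProduct.smul_tmul', map_smul,
      braidedMul_tmul_eq_sum X Y _ e f (pow_mul_eq_zero (act_leibniz Y (tensorAct_A Y Y)) hk hd), Finset.smul_sum,
      ← sum_antidiagonal_eq (F k) (fun p q hp => by simp [F, hzero (p + k) (by omega)])
        (fun p q hq => by simp [F, hzero' q hq])]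
    refine Finset.sum_congr rfl fun l _ => ?_
    rw [← TensorProduct.tmul_smul, ← smul_mul_assoc, pow_leibniz Y (tensorAct_A Y Y),
      Finset.sum_mul, TensorProduct.tmul_sum, Finset.smul_sum]
    refine Finset.sum_congr rfl fun p hp => ?_
    rw [Finset.HasAntidiagonal.mem_antidiagonal] at hp
    simp only [F]
    rw [smul_mul_assoc, TensorProduct.tmul_smul, smul_smul, hp, pow_add D,
      Module.End.mul_apply]
  have hR : braidedMul X Y ((a ⊗ₜ b) ⊗ₜ braidedMul X Y ((c ⊗ₜ d) ⊗ₜ (e ⊗ₜ f)))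
      = ∑ q ∈ Finset.range n, ∑ k ∈ Finset.range n, ∑ p ∈ Finset.range n, F k p q := by
    rw [braidedMul_tmul_eq_sum X Y c e f hd, TensorProduct.tmul_sum, map_sum]
    refine Finset.sum_congr rfl fun q _ => ?_
    rw [TensorProduct.tmul_smul, map_smul,
      braidedMul_tmul_eq_sum X Y a _ _ (hzero (2 * n) (by omega)), Finset.smul_sum,
      ← sum_antidiagonal_eq (fun k p => F k p q) (fun k p hp => by simp [F, hzero (p + k) (by omega)])
        (fun k p hq => by simp [F, hzero (p + k) (by omega)])]
    refine Finset.sum_congr rfl fun l _ => ?_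
    rw [TensorProduct.smul_tmul', ← mul_smul_comm, pow_leibniz X (tensorAct_Ad X X),
      Finset.mul_sum, TensorProduct.sum_tmul, Finset.smul_sum]
    refine Finset.sum_congr rfl fun p hp => ?_
    rw [Finset.HasAntidiagonal.mem_antidiagonal] at hp
    simp only [F]
    rw [mul_smul_comm, ← TensorProduct.smul_tmul', smul_smul, add_comm p.2 p.1, hp, pow_add E,
      Module.End.mul_apply]
    congr 1
    · simp only [c']
      ring
    · rw [mul_assoc a, mul_assoc ((D ^ l) b)]
  rw [hL, hR]
  exact (Finset.sum_congr rfl fun k _ => Finset.sum_comm).trans Finset.sum_comm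

theorem act_A_one : X.act (Uq.A ω) 1 = 0 := by
  rw [X.act_one, Uq.counit_gen]; simp [Uq.counitGen]

theorem act_Ad_one : X.act (Uq.Ad ω) 1 = 0 := by
  rw [X.act_one, Uq.counit_gen]; simp [Uq.counitGen]

theorem one_braidedMul (t : X.carrier ⊗[ℂ] Y.carrier) :
    braidedMul X Y ((1 ⊗ₜ 1) ⊗ₜ t) = t := by
  induction t with
  | zero => simp
  | add u v hu hv => rw [TensorProduct.tmul_add, map_add, hu, hv]
  | tmul c d =>
    rw [braidedMul_tmul_eq_sum X Y 1 c d (n := 1) (by simp [act_A_one])]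
    simp

theorem braidedMul_one (t : X.carrier ⊗[ℂ] Y.carrier) :
    braidedMul X Y (t ⊗ₜ (1 ⊗ₜ 1)) = t := by
  induction t with
  | zero => simp
  | add u v hu hv => rw [TensorProduct.add_tmul, map_add, hu, hv]
  | tmul a b =>
    obtain ⟨n, hn⟩ := Y.act_A_locNil b
    rw [braidedMul_tmul_eq_sum X Y a 1 1 (pow_apply_eq_zero_of_le (Nat.le_succ n) hn),
      Finset.sum_range_succ', Finset.sum_eq_zero]
    · simp
    · intro k _
      rw [pow_succ (X.act (Uq.Ad ω)), Module.End.mul_apply, act_Ad_one]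
      simp

instance : Ring (BTensor X Y) :=
  { (inferInstance : AddCommGroup (BTensor X Y)) with
    mul := fun u v => braidedMul X Y (u ⊗ₜ v)
    one := (1 : X.carrier) ⊗ₜ[ℂ] (1 : Y.carrier)
    left_distrib := fun u v w =>
      (congrArg (braidedMul X Y) (TensorProduct.tmul_add _ _ _)).trans (map_add _ _ _)
    right_distrib := fun u v w =>
      (congrArg (braidedMul X Y) (TensorProduct.add_tmul _ _ _)).trans (map_add _ _ _)
    zero_mul := fun u =>
      (congrArg (braidedMul X Y) (TensorProduct.zero_tmul _ _)).trans (map_zero _)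
    mul_zero := fun u =>
      (congrArg (braidedMul X Y) (TensorProduct.tmul_zero _ _)).trans (map_zero _)
    mul_assoc := braidedMul_assoc X Y
    one_mul := one_braidedMul X Y
    mul_one := braidedMul_one X Y }

theorem smul_braidedMul (c : ℂ) (u v : X.carrier ⊗[ℂ] Y.carrier) :
    braidedMul X Y ((c • u) ⊗ₜ v) = c • braidedMul X Y (u ⊗ₜ v) := by
  rw [← TensorProduct.smul_tmul', map_smul]

theorem braidedMul_smul (c : ℂ) (u v : X.carrier ⊗[ℂ] Y.carrier) :
    braidedMul X Y (u ⊗ₜ (c • v)) = c • braidedMul X Y (u ⊗ₜ v) := by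
  rw [TensorProduct.tmul_smul, map_smul]

instance : Algebra ℂ (BTensor X Y) :=
  Algebra.ofModule (smul_braidedMul X Y) (braidedMul_smul X Y)

/-- The action of `U_q(h)` on the braided tensor product. -/
def BTensor.act : Uq ω →ₐ[ℂ] Module.End ℂ (BTensor X Y) := tensorAct X.act Y.act

theorem BTensor.mul'_tmul (u v : BTensor X Y) :
    LinearMap.mul' ℂ (BTensor X Y) (u ⊗ₜ v) = braidedMul X Y (u ⊗ₜ v) := rfl

theorem tensorAct_one (h : Uq ω) :
    tensorAct X.act Y.act h (1 ⊗ₜ 1)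
      = Uq.counit ω h • ((1 : X.carrier) ⊗ₜ[ℂ] (1 : Y.carrier)) := by
  have hN : ∀ Z : ModAlg ω, Z.act (Uq.N ω) 1 = 0 := fun Z => by
    rw [Z.act_one, Uq.counit_gen]; simp [Uq.counitGen]
  induction h using Uq.gen_induction with
  | hg g =>
    rw [Uq.counit_gen]
    cases g
    · rw [tensorAct_A]; simp [act_A_one, Uq.counitGen]
    · rw [tensorAct_Ad]; simp [act_Ad_one, Uq.counitGen]
    · rw [tensorAct_N]; simp [hN, Uq.counitGen]
    · rw [tensorAct_H]; simp [Uq.counitGen]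
    · rw [tensorAct_gen_K]; simp [Uq.counitGen]
    · rw [tensorAct_gen_Kinv]; simp [Uq.counitGen]
  | hc c => rw [AlgHom.commutes, AlgHom.commutes]; rfl
  | ha x y hx hy => rw [map_add, map_add, LinearMap.add_apply, hx, hy, add_smul]
  | hm x y hx hy => rw [map_mul, map_mul, Module.End.mul_apply, hy, map_smul, hx, smul_smul, mul_comm]

/-- `A`, `A†` and `N` act on the braided tensor product as derivations. -/
theorem BTensor.leibniz {h : Uq ω}
    (hXY : tensorAct X.act Y.act h = TensorProduct.map 1 (Y.act h) + TensorProduct.map (X.act h) 1)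
    (hYX : tensorAct Y.act X.act h = TensorProduct.map 1 (X.act h) + TensorProduct.map (Y.act h) 1)
    (hX : tensorAct X.act X.act h = TensorProduct.map 1 (X.act h) + TensorProduct.map (X.act h) 1)
    (hY : tensorAct Y.act Y.act h = TensorProduct.map 1 (Y.act h) + TensorProduct.map (Y.act h) 1)
    (hc : Commute (tensorAct Y.act X.act h) (exponentA Y X)) (u v : X.carrier ⊗[ℂ] Y.carrier) :
    tensorAct X.act Y.act h (braidedMul X Y (u ⊗ₜ v))
      = braidedMul X Y (u ⊗ₜ tensorAct X.act Y.act h v)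
        + braidedMul X Y (tensorAct X.act Y.act h u ⊗ₜ v) := by
  induction u with
  | zero => simp
  | add u₁ u₂ h₁ h₂ => simp only [TensorProduct.add_tmul, map_add, h₁, h₂]; abel
  | tmul a b =>
  induction v with
  | zero => simp
  | add u₁ u₂ h₁ h₂ => simp only [TensorProduct.tmul_add, map_add, h₁, h₂]; abel
  | tmul c d =>
  have hb := braiding_comm Y X hc hYX hXY (b ⊗ₜ c)
  have key : ∀ t : X.carrier ⊗[ℂ] Y.carrier,
      tensorAct X.act Y.act h
          (TensorProduct.map (LinearMap.mulLeft ℂ a) (LinearMap.mulRight ℂ d) t)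
        = TensorProduct.map (LinearMap.mulLeft ℂ (X.act h a)) (LinearMap.mulRight ℂ d) t
        + TensorProduct.map (LinearMap.mulLeft ℂ a) (LinearMap.mulRight ℂ (Y.act h d)) t
        + TensorProduct.map (LinearMap.mulLeft ℂ a) (LinearMap.mulRight ℂ d)
            (tensorAct X.act Y.act h t) := by
    intro t
    induction t with
    | zero => simp
    | add u₁ u₂ h₁ h₂ => simp only [map_add, h₁, h₂]; abel
    | tmul x y =>
      simp only [hXY, LinearMap.add_apply, TensorProduct.map_tmul, Module.End.one_apply, map_add,
        LinearMap.mulLeft_apply, LinearMap.mulRight_apply, act_leibniz X hX, act_leibniz Y hY,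
        TensorProduct.tmul_add, TensorProduct.add_tmul]
      abel
  rw [braidedMul_tmul, key, ← hb]
  simp only [hXY, hYX, LinearMap.add_apply, TensorProduct.map_tmul, Module.End.one_apply,
    TensorProduct.tmul_add, TensorProduct.add_tmul, map_add, braidedMul_tmul]
  abel

theorem commute_A : Commute (tensorAct X.act Y.act (Uq.A ω)) (exponentA X Y) := by
  rw [tensorAct_A, exponentA_eq]
  refine Commute.smul_right ?_ _
  rw [Commute, SemiconjBy, add_mul, mul_add]
  simp only [← TensorProduct.map_mul, one_mul, mul_one, act_A_comm_act_Ad]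

theorem commute_Ad : Commute (tensorAct X.act Y.act (Uq.Ad ω)) (exponentA X Y) := by
  rw [tensorAct_Ad, exponentA_eq]
  refine Commute.smul_right ?_ _
  rw [Commute, SemiconjBy, add_mul, mul_add]
  simp only [← TensorProduct.map_mul, one_mul, mul_one, act_A_comm_act_Ad]

theorem commute_N : Commute (tensorAct X.act Y.act (Uq.N ω)) (exponentA X Y) := by
  rw [tensorAct_N, exponentA_eq]
  refine Commute.smul_right ?_ _
  rw [Commute, SemiconjBy, add_mul, mul_add]
  have hA : X.act (Uq.N ω) * X.act (Uq.A ω)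
      = X.act (Uq.A ω) * X.act (Uq.N ω) + (-1 : ℂ) • X.act (Uq.A ω) := by
    rw [← map_mul, Uq.N_mul_A, map_sub, map_mul]; module
  have hAd : Y.act (Uq.N ω) * Y.act (Uq.Ad ω)
      = Y.act (Uq.Ad ω) * Y.act (Uq.N ω) + Y.act (Uq.Ad ω) := by
    rw [← map_mul, Uq.N_mul_Ad, map_add, map_mul]
  simp only [← TensorProduct.map_mul, one_mul, mul_one, hA, hAd, TensorProduct.map_add_right,
    TensorProduct.map_add_left, TensorProduct.map_smul_left]
  module

/-- An action of `U_q(h)` on an algebra for which `H` acts by zero, `e^{ωH/4}` as the identity and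
`A`, `A†`, `N` as derivations makes the product a morphism of `U_q(h)`-modules. -/
theorem act_mul_of_leibniz {V : Type*} [Ring V] [Algebra ℂ V] (act : Uq ω →ₐ[ℂ] Module.End ℂ V)
    (hH : act (Uq.H ω) = 0) (hK : act (Uq.gen ω .K) = 1)
    (hA : ∀ x y, act (Uq.A ω) (x * y) = x * act (Uq.A ω) y + act (Uq.A ω) x * y)
    (hAd : ∀ x y, act (Uq.Ad ω) (x * y) = x * act (Uq.Ad ω) y + act (Uq.Ad ω) x * y)
    (hN : ∀ x y, act (Uq.N ω) (x * y) = x * act (Uq.N ω) y + act (Uq.N ω) x * y)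
    (h : Uq ω) (t : V ⊗[ℂ] V) :
    act h (LinearMap.mul' ℂ V t) = LinearMap.mul' ℂ V (tensorAct act act h t) := by
  have prim : ∀ h : Uq ω, tensorAct act act h
        = TensorProduct.map 1 (act h) + TensorProduct.map (act h) 1 →
      (∀ x y, act h (x * y) = x * act h y + act h x * y) →
      ∀ t, act h (LinearMap.mul' ℂ V t) = LinearMap.mul' ℂ V (tensorAct act act h t) := by
    intro h h₁ h₂ t
    rw [h₁]
    induction t with
    | zero => simp
    | tmul u v => simp [h₂]
    | add x y hx hy => simp only [map_add, hx, hy]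
  have hKinv : act (Uq.gen ω .Kinv) = 1 := by
    have h := congrArg act (Uq.gen_K_mul_gen_Kinv ω)
    rwa [map_mul, hK, one_mul, map_one] at h
  have hT : ∀ g, tensorAct act act (Uq.gen ω g)
      = Module.endTensorEndAlgHom (R := ℂ) (S := ℂ) (A := ℂ)
        (Algebra.TensorProduct.map act act (Uq.comulGen ω g)) := by
    intro g
    rw [← Uq.comul_gen]
    rfl
  induction h using Uq.gen_induction generalizing t with
  | hg g =>
    cases g
    · refine prim _ ?_ hA t
      rw [hT]
      simp only [Uq.comulGen, map_add, Algebra.TensorProduct.map_tmul, end_tmul, hK, hKinv]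
    · refine prim _ ?_ hAd t
      rw [hT]
      simp only [Uq.comulGen, map_add, Algebra.TensorProduct.map_tmul, end_tmul, hK, hKinv]
    · refine prim _ ?_ hN t
      rw [hT]
      simp only [Uq.comulGen, map_add, Algebra.TensorProduct.map_tmul, end_tmul, map_one]
      exact add_comm _ _
    · rw [hT, hH]
      simp only [Uq.comulGen, map_add, Algebra.TensorProduct.map_tmul, end_tmul, hH,
        TensorProduct.map_zero_left, TensorProduct.map_zero_right, add_zero, LinearMap.zero_apply,
        map_zero]
    · rw [hT, hK]
      simp only [Uq.comulGen, Algebra.TensorProduct.map_tmul, end_tmul, hK, TensorProduct.map_one,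
        Module.End.one_apply]
    · rw [hT, hKinv]
      simp only [Uq.comulGen, Algebra.TensorProduct.map_tmul, end_tmul, hKinv,
        TensorProduct.map_one, Module.End.one_apply]
  | hc c => simp only [AlgHom.commutes]; simp [Algebra.algebraMap_eq_smul_one]
  | ha x y hx hy => simp only [map_add, LinearMap.add_apply, hx, hy]
  | hm x y hx hy => simp only [map_mul, Module.End.mul_apply, hx, hy]

theorem BTensor.act_mul (h : Uq ω) (t : BTensor X Y ⊗[ℂ] BTensor X Y) :
    BTensor.act X Y h (LinearMap.mul' ℂ (BTensor X Y) t)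
      = LinearMap.mul' ℂ (BTensor X Y) (tensorAct (BTensor.act X Y) (BTensor.act X Y) h t) :=
  act_mul_of_leibniz (BTensor.act X Y) (tensorAct_H X Y) (tensorAct_gen_K X Y)
    (BTensor.leibniz X Y (tensorAct_A X Y) (tensorAct_A Y X) (tensorAct_A X X)
      (tensorAct_A Y Y) (commute_A Y X))
    (BTensor.leibniz X Y (tensorAct_Ad X Y) (tensorAct_Ad Y X) (tensorAct_Ad X X)
      (tensorAct_Ad Y Y) (commute_Ad Y X))
    (BTensor.leibniz X Y (tensorAct_N X Y) (tensorAct_N Y X) (tensorAct_N X X)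
      (tensorAct_N Y Y) (commute_N Y X)) h t

/-- The braided tensor product `X ⊗̲ Y`. -/
abbrev braidedTensor : ModAlg ω where
  carrier := BTensor X Y
  act := BTensor.act X Y
  act_one := tensorAct_one X Y
  act_mul := BTensor.act_mul X Y
  act_H := tensorAct_H X Y
  act_K := tensorAct_gen_K X Y
  act_A_locNil := by
    have h := X.act_A_locNil.sum_map Y.act_A_locNil
    rw [← tensorAct_A] at h
    exact h

variable (ω)

/-- The unit object: the ground field with the trivial action. -/
abbrev unit : ModAlg ω where
  carrier := ℂ
  act := (Algebra.lmul ℂ ℂ).comp (Uq.counit ω)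
  act_one h := by simp
  act_mul h t := act_mul_of_leibniz _ (by simp [Uq.counit_gen, Uq.counitGen])
    (by rw [AlgHom.comp_apply, Uq.counit_gen]; exact map_one _)
    (by simp [Uq.counit_gen, Uq.counitGen]) (by simp [Uq.counit_gen, Uq.counitGen])
    (by simp [Uq.counit_gen, Uq.counitGen]) h t
  act_H := by simp [Uq.counit_gen, Uq.counitGen]
  act_K := by
    rw [← Uq.gen_K, AlgHom.comp_apply, Uq.counit_gen]
    exact map_one _
  act_A_locNil := fun v => ⟨1, by simp [Uq.counit_gen, Uq.counitGen]⟩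

theorem adjoint_one (h : Uq ω) : Uq.adjoint ω h 1 = Uq.counit ω h • (1 : Uq ω) := by
  induction h using Uq.gen_induction with
  | hg g =>
    rw [Uq.counit_gen]
    cases g
    · rw [Uq.adjoint_A]; simp [Uq.counitGen]
    · rw [Uq.adjoint_Ad]; simp [Uq.counitGen]
    · rw [Uq.adjoint_N]; simp [Uq.counitGen]
    · rw [Uq.adjoint_H]; simp [Uq.counitGen]
    · rw [Uq.adjoint_K]; simp [Uq.counitGen]
    · have h := congrArg (Uq.adjoint ω) (Uq.gen_K_mul_gen_Kinv ω)
      rw [map_mul, Uq.adjoint_K, one_mul, map_one] at h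
      rw [h]; simp [Uq.counitGen]
  | hc c => rw [AlgHom.commutes, AlgHom.commutes]; rfl
  | ha x y hx hy => rw [map_add, map_add, LinearMap.add_apply, hx, hy, add_smul]
  | hm x y hx hy => rw [map_mul, map_mul, Module.End.mul_apply, hy, map_smul, hx, smul_smul, mul_comm]

theorem adjoint_A_leibniz (x y : Uq ω) : Uq.adjoint ω (Uq.A ω) (x * y)
    = x * Uq.adjoint ω (Uq.A ω) y + Uq.adjoint ω (Uq.A ω) x * y := by
  simp only [Uq.adjoint_A, Uq.gen_Kinv]
  rw [← mul_assoc x, ← Uq.Kinv_comm x]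
  noncomm_ring

theorem adjoint_Ad_leibniz (x y : Uq ω) : Uq.adjoint ω (Uq.Ad ω) (x * y)
    = x * Uq.adjoint ω (Uq.Ad ω) y + Uq.adjoint ω (Uq.Ad ω) x * y := by
  simp only [Uq.adjoint_Ad, Uq.gen_Kinv]
  rw [← mul_assoc x, ← Uq.Kinv_comm x]
  noncomm_ring

theorem adjoint_N_leibniz (x y : Uq ω) : Uq.adjoint ω (Uq.N ω) (x * y)
    = x * Uq.adjoint ω (Uq.N ω) y + Uq.adjoint ω (Uq.N ω) x * y := by
  simp only [Uq.adjoint_N]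
  noncomm_ring

theorem adjoint_A_locNil : LocNil (Uq.adjoint ω (Uq.A ω)) := by
  have hz : ∀ z : Uq ω, Uq.A ω * z = z * Uq.A ω → Uq.adjoint ω (Uq.A ω) z = 0 := by
    intro z h; rw [Uq.adjoint_A, h, sub_self, mul_zero]
  have hK : Uq.adjoint ω (Uq.A ω) (Uq.gen ω .K) = 0 := hz _ (Uq.K_comm _).symm
  have hKinv : Uq.adjoint ω (Uq.A ω) (Uq.gen ω .Kinv) = 0 := hz _ (Uq.Kinv_comm _).symm
  intro x
  induction x using Uq.gen_induction with
  | hg g =>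
    cases g
    · exact ⟨1, by rw [pow_one]; exact hz _ rfl⟩
    · refine ⟨2, ?_⟩
      rw [pow_two, Module.End.mul_apply, Uq.adjoint_A ω (Uq.Ad ω), Uq.A_mul_Ad, add_sub_cancel_left,
        Uq.brH_eq]
      simp [adjoint_A_leibniz, hK, hKinv, pow_two]
    · refine ⟨2, ?_⟩
      rw [pow_two, Module.End.mul_apply, Uq.adjoint_A ω (Uq.N ω), Uq.N_mul_A, sub_sub_cancel,
        adjoint_A_leibniz, hKinv, hz _ rfl]
      simp
    · exact ⟨1, by rw [pow_one]; exact hz _ (Uq.H_comm _).symm⟩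
    · exact ⟨1, by rw [pow_one]; exact hK⟩
    · exact ⟨1, by rw [pow_one]; exact hKinv⟩
  | hc c => exact ⟨1, by rw [pow_one]; exact hz _ (Algebra.commutes c _).symm⟩
  | ha x y hx hy =>
    obtain ⟨m, hm⟩ := hx
    obtain ⟨n, hn⟩ := hy
    exact ⟨max m n, by rw [map_add, pow_apply_eq_zero_of_le (le_max_left m n) hm,
      pow_apply_eq_zero_of_le (le_max_right m n) hn, add_zero]⟩
  | hm x y hx hy =>
    obtain ⟨m, hm⟩ := hx
    obtain ⟨n, hn⟩ := hy
    exact ⟨2 * max m n, pow_mul_eq_zero (adjoint_A_leibniz ω)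
      (pow_apply_eq_zero_of_le (le_max_left m n) hm)
      (pow_apply_eq_zero_of_le (le_max_right m n) hn)⟩

/-- `BU_q(h)`: the algebra `U_q(h)` as an algebra in the category of `U_q(h)`-modules under the
quantum adjoint action. -/
abbrev BUq : ModAlg ω where
  carrier := Uq ω
  act := Uq.adjoint ω
  act_one := adjoint_one ω
  act_mul := act_mul_of_leibniz _ (Uq.adjoint_H ω) (Uq.adjoint_K ω) (adjoint_A_leibniz ω)
    (adjoint_Ad_leibniz ω) (adjoint_N_leibniz ω)
  act_H := Uq.adjoint_H ω
  act_K := Uq.adjoint_K ω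
  act_A_locNil := adjoint_A_locNil ω

/-- The `n`-fold braided tensor product of `BU_q(h)`, obtained by iterating the braided tensor
product: the `(n+1)`-fold product is the `n`-fold one braided with one more copy of `BU_q(h)`. -/
def BUqPow : ℕ → ModAlg ω
  | 0 => unit ω
  | n + 1 => braidedTensor (BUqPow n) (BUq ω)

end ModAlg

/-- The underlying algebra of the `n`-fold braided tensor product of `BU_q(h)`. -/
abbrev BUqTensor (ω : ℂ) (n : ℕ) : Type := (ModAlg.BUqPow ω n).carrier

namespace BUqTensor

variable {ω : ℂ}

/-- The element `x₁ ⊗ ⋯ ⊗ xₙ` of the `n`-fold braided tensor product. -/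
def pureTensor : {n : ℕ} → (Fin n → Uq ω) → BUqTensor ω n
  | 0, _ => (1 : ℂ)
  | n + 1, x => (pureTensor (fun i : Fin n => x i.castSucc) ⊗ₜ[ℂ] x (Fin.last n) :
      (ModAlg.BUqPow ω n).carrier ⊗[ℂ] Uq ω)

/-- The element with `x` in the `i`-th place and `1` elsewhere. -/
def place {n : ℕ} (i : Fin n) (x : Uq ω) : BUqTensor ω n := pureTensor (Pi.mulSingle i x)

/-- The central element `e^{(ω/4) ∑ₖ mₖ H̄ₖ}`, the tensor product of the elements `e^{mₖ ωH/4}`. -/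
def expH {n : ℕ} (m : Fin n → ℤ) : BUqTensor ω n :=
  pureTensor fun k => ((Uq.K ω ^ m k : (Uq ω)ˣ) : Uq ω)

variable (ω) {n : ℕ} (i : Fin n)

/-- `X̄ᵢ = e^{-(ω/2) ∑_{k<i} H̄ₖ} Āᵢ`. -/
def X : BUqTensor ω n := expH (fun k => if k < i then -2 else 0) * place i (Uq.A ω)

/-- `X̄†ᵢ = e^{(ω/2) ∑_{k<i} H̄ₖ} Ā†ᵢ - ω [H̄ᵢ] e^{-ωH̄ᵢ/4}
∑_{j<i} e^{(ω/2) ∑_{k<j} H̄ₖ} e^{ωH̄ⱼ/4} e^{-(ω/2) ∑_{j<k<i} H̄ₖ} Ā†ⱼ`. -/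
def Xd : BUqTensor ω n :=
  expH (fun k => if k < i then 2 else 0) * place i (Uq.Ad ω)
    - ω • (place i (Uq.brH ω) * expH (Pi.single i (-1)) *
        ∑ j ∈ Finset.univ.filter (· < i),
          expH (fun k => if k < j then 2 else 0) * expH (Pi.single j 1) *
            expH (fun k => if j < k ∧ k < i then -2 else 0) * place j (Uq.Ad ω))

/-- `M̄ᵢ = N̄ᵢ - ω e^{-ωH̄ᵢ/4} ∑_{j<i} e^{-ωH̄ⱼ/4} e^{-ω ∑_{j<k<i} H̄ₖ} Ā†ⱼ Āᵢ`, which is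
`N̄ᵢ + [H̄ᵢ]⁻¹ (X̄†ᵢ X̄ᵢ - Ā†ᵢ Āᵢ)` with the division by `[H̄ᵢ]` carried out. -/
def M : BUqTensor ω n :=
  place i (Uq.N ω) - ω • (expH (Pi.single i (-1)) *
    ∑ j ∈ Finset.univ.filter (· < i),
      expH (Pi.single j (-1)) * expH (fun k => if j < k ∧ k < i then -4 else 0) *
        place j (Uq.Ad ω) * place i (Uq.A ω))

end BUqTensor

end BraidedHeisenberg

end

/-! Write K for e^{ωH/4}. The theorem is an induction on the number of factors, and its content is a
statement about one braided product `X ⊗̲ BU_q(h)`.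

Since H acts by zero, the R-matrix acts as exp(ω A ⊗ A†). Hence an element b of the right factor
passes an element c of the left one by bc = cb + ω (A† ▷ c)(A ▷ b) whenever A ▷ (A ▷ b) = 0. Among
the generators b only two feel a correction: A ▷ A† = K⁻¹[H] and A ▷ N = K⁻¹A. Suppose A† acts on X
as the commutator with an element Z (`IsInner`). The corrections are then ω[Z,c]K⁻¹[H] and
ω[Z,c]K⁻¹A, and replacing A† by A† - ωZK⁻¹[H] and N by N - ωZK⁻¹A removes them: the new elements
commute with X. They still satisfy the relations of U_q(h), also after scaling A by W⁻¹ and A† by W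
for a central unit W (`Uq.twist`). So U_q(h) maps into the centralizer of X. This gives a
homomorphism from the ordinary product X ⊗ U_q(h), and a second twist gives its inverse
(`IsInner.equiv`).

To iterate, the action of A† on every braided power must be inner (`act_Ad_and_expH_comm`). On one
copy A† ▷ x = K⁻¹[A†, x], so Z₁ = K⁻¹A†. In general Zₙ₊₁ = ZₙK⁻⁴ + K⁻¹A†, with K and A† in the new
place. Indeed, the commutator of K⁻¹A† with c from the first n factors is [Zₙ,c] ωK⁻²[H] = [Zₙ,c](1
- K⁻⁴), which the factor K⁻⁴ compensates. With W = e^{(ω/2)ΣH̄ₖ}, expanding the twisted generators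
gives X̄, X̄† and M̄ for the last index; those for smaller indices come from the smaller power.

Uniqueness holds because the copies of the generators in all places generate the ordinary tensor
power, so the inverse of φ is determined. -/

noncomputable section

/-! ### Splitting one factor off an ordinary tensor power. -/

namespace PiTensorProduct

variable {R A : Type*} [CommSemiring R] [Semiring A] [Algebra R A] (n : ℕ)

/-- The linear equivalence splitting off the last factor of a tensor power. -/
def snocLinearEquiv : (⨂[R] _ : Fin n, A) ⊗[R] A ≃ₗ[R] ⨂[R] _ : Fin (n + 1), A :=
  (TensorProduct.congr (LinearEquiv.refl R _)
      (subsingletonEquiv (R := R) (s := fun _ : Fin 1 => A) 0).symm).trans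
    ((tmulEquiv R A).trans (reindex R (fun _ => A) finSumFinEquiv))

theorem snocLinearEquiv_tmul (a : Fin n → A) (b : A) :
    snocLinearEquiv n (tprod R a ⊗ₜ[R] b) = tprod R (Fin.snoc a b : Fin (n + 1) → A) := by
  simp only [snocLinearEquiv, LinearEquiv.trans_apply, TensorProduct.congr_tmul,
    LinearEquiv.refl_apply, subsingletonEquiv_symm_apply', tmulEquiv_apply, reindex_tprod]
  congr 1
  ext i
  induction i using Fin.lastCases with
  | last =>
    have h : finSumFinEquiv.symm (Fin.last n) = (Sum.inr 0 : Fin n ⊕ Fin 1) := by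
      rw [Equiv.symm_apply_eq]; rfl
    rw [h]; simp
  | cast i =>
    have h : finSumFinEquiv.symm i.castSucc = (Sum.inl i : Fin n ⊕ Fin 1) := by
      rw [Equiv.symm_apply_eq]; rfl
    rw [h]; simp

/-- The algebra equivalence splitting off the last factor of a tensor power. -/
def snocAlgEquiv : (⨂[R] _ : Fin n, A) ⊗[R] A ≃ₐ[R] ⨂[R] _ : Fin (n + 1), A :=
  Algebra.TensorProduct.algEquivOfLinearEquivTensorProduct (snocLinearEquiv n)
    (by
      intro a₁ a₂ b₁ b₂
      have h : ∀ a b, snocLinearEquiv (R := R) n ((tprod R a * tprod R b) ⊗ₜ (b₁ * b₂))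
          = snocLinearEquiv n (tprod R a ⊗ₜ b₁) * snocLinearEquiv n (tprod R b ⊗ₜ b₂) := by
        intro a b
        rw [tprod_mul_tprod, snocLinearEquiv_tmul, snocLinearEquiv_tmul, snocLinearEquiv_tmul,
          tprod_mul_tprod]
        congr 1
        ext i
        induction i using Fin.lastCases <;> simp
      induction a₁ using PiTensorProduct.induction_on with
      | smul_tprod r a =>
        induction a₂ using PiTensorProduct.induction_on with
        | smul_tprod s b =>
          simp only [smul_mul_assoc, mul_smul_comm, ← TensorProduct.smul_tmul', map_smul, h]
        | add x y hx hy => simp only [mul_add, TensorProduct.add_tmul, map_add, hx, hy]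
      | add x y hx hy => simp only [add_mul, TensorProduct.add_tmul, map_add, hx, hy])
    (by
      rw [PiTensorProduct.one_def, PiTensorProduct.one_def, snocLinearEquiv_tmul]
      congr 1
      ext i
      induction i using Fin.lastCases <;> simp)

theorem snocAlgEquiv_tmul (a : Fin n → A) (b : A) :
    snocAlgEquiv (R := R) (A := A) n (tprod R a ⊗ₜ[R] b) = tprod R (Fin.snoc a b : Fin (n + 1) → A) :=
  snocLinearEquiv_tmul n a b

theorem snocAlgEquiv_singleAlgHom_tmul_one (i : Fin n) (x : A) :
    snocAlgEquiv (R := R) (A := A) n (singleAlgHom (A := fun _ : Fin n => A) i x ⊗ₜ[R] 1)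
      = singleAlgHom (A := fun _ : Fin (n + 1) => A) i.castSucc x := by
  rw [singleAlgHom_apply, snocAlgEquiv_tmul, singleAlgHom_apply]
  congr 1
  ext j
  induction j using Fin.lastCases with
  | last => simp [(Fin.castSucc_lt_last i).ne']
  | cast j => simp [Pi.mulSingle_apply]

theorem snocAlgEquiv_one_tmul (x : A) :
    snocAlgEquiv (R := R) (A := A) n ((1 : ⨂[R] _ : Fin n, A) ⊗ₜ[R] x)
      = singleAlgHom (A := fun _ : Fin (n + 1) => A) (Fin.last n) x := by
  rw [PiTensorProduct.one_def, snocAlgEquiv_tmul, singleAlgHom_apply]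
  congr 1
  ext j
  induction j using Fin.lastCases with
  | last => simp
  | cast j => simp [(Fin.castSucc_lt_last j).ne]

/-- The tensor product of an empty family of algebras is the ground ring. -/
def isEmptyAlgEquiv (R A : Type*) [CommSemiring R] [Semiring A] [Algebra R A] :
    (⨂[R] _ : Fin 0, A) ≃ₐ[R] R :=
  AlgEquiv.ofLinearEquiv (isEmptyEquiv (R := R) (s := fun _ : Fin 0 => A) (Fin 0))
    (by rw [PiTensorProduct.one_def, isEmptyEquiv_apply_tprod])
    (by
      -- The empty tensor power is spanned by 1, so multiplicativity is a statement about scalars.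
      have h : ∀ x : ⨂[R] _ : Fin 0, A, ∃ r : R, x = r • 1 := fun x =>
        ⟨isEmptyEquiv (Fin 0) x, (isEmptyEquiv (Fin 0)).injective (by
          rw [map_smul, PiTensorProduct.one_def, isEmptyEquiv_apply_tprod, smul_eq_mul, mul_one])⟩
      intro x y
      obtain ⟨r, rfl⟩ := h x
      obtain ⟨s, rfl⟩ := h y
      rw [smul_mul_smul_comm, one_mul, map_smul, map_smul, map_smul, PiTensorProduct.one_def,
        isEmptyEquiv_apply_tprod]
      simp)

end PiTensorProduct

end

noncomputable section

namespace BraidedHeisenberg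

/-! ### Identities in U_q(h) and twisted homomorphisms. -/

namespace Uq

variable {ω : ℂ}

theorem brH_comm (x : Uq ω) : brH ω * x = x * brH ω := by
  have h₁ : Commute (gen ω .K) x := K_comm x
  have h₂ : Commute (gen ω .Kinv) x := Kinv_comm x
  rw [brH_eq]
  exact ((h₁.pow_left 2).sub_left (h₂.pow_left 2)).smul_left ω⁻¹

theorem Kinv_mul_brH_comm (x : Uq ω) :
    gen ω .Kinv * brH ω * x = x * (gen ω .Kinv * brH ω) := by
  have h₁ : Commute (gen ω .Kinv) x := Kinv_comm x
  exact h₁.mul_left (brH_comm x)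

/-- K⁻¹A is both A ▷ N and the correction to N in `twist`. That it commutes with A stops the
exchange series for N at first order and preserves [N, A] = -A. -/
theorem A_mul_Kinv_mul_A : A ω * (gen ω .Kinv * A ω) = gen ω .Kinv * A ω * A ω := by
  rw [gen_Kinv, ← mul_assoc, ← Kinv_comm]

theorem Kinv_mul_A_mul_Ad :
    gen ω .Kinv * A ω * Ad ω = Ad ω * (gen ω .Kinv * A ω) + gen ω .Kinv * brH ω := by
  rw [mul_assoc, A_mul_Ad, mul_add, ← mul_assoc, ← mul_assoc, gen_Kinv, Kinv_comm (Ad ω)]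

/-- Two algebra homomorphisms out of `U_q(h)` that agree on `A`, `A†`, `N`, `H` and `e^{ωH/4}` are
equal. -/
theorem algHom_ext {B : Type*} [Ring B] [Algebra ℂ B] {f g : Uq ω →ₐ[ℂ] B}
    (hA : f (A ω) = g (A ω)) (hAd : f (Ad ω) = g (Ad ω)) (hN : f (N ω) = g (N ω))
    (hH : f (H ω) = g (H ω)) (hK : f (gen ω .K) = g (gen ω .K)) : f = g := by
  have hKinv : f (gen ω .Kinv) = g (gen ω .Kinv) := by
    refine left_inv_eq_right_inv (a := f (gen ω .K)) ?_ ?_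
    · rw [← map_mul, gen_Kinv_mul_gen_K, map_one]
    · rw [hK, ← map_mul, gen_K_mul_gen_Kinv, map_one]
  ext x
  induction x using gen_induction with
  | hg g => cases g <;> assumption
  | hc c => rw [AlgHom.commutes, AlgHom.commutes]
  | ha x y hx hy => rw [map_add, map_add, hx, hy]
  | hm x y hx hy => rw [map_mul, map_mul, hx, hy]

section Twist

variable {B : Type*} [Ring B] [Algebra ℂ B] (r : Uq ω →ₐ[ℂ] B) (p q z : B)

/-- The images of the generators under `twist`. -/
def twistGen : Gen → B
  | .A => p * r (A ω)
  | .Ad => q * (r (Ad ω) + ω • (z * r (gen ω .Kinv * brH ω)))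
  | .N => r (N ω) + ω • (z * r (gen ω .Kinv * A ω))
  | .H => r (H ω)
  | .K => r (gen ω .K)
  | .Kinv => r (gen ω .Kinv)

/-- A homomorphism `r` out of `U_q(h)` may be twisted by commuting elements `p`, `q = p⁻¹` and `z`
of the centralizer of its image. -/
def twist (hpq : p * q = 1) (hqp : q * p = 1) (hzp : z * p = p * z) (hzq : z * q = q * z)
    (hp : ∀ x, r x * p = p * r x) (hq : ∀ x, r x * q = q * r x) (hz : ∀ x, r x * z = z * r x) :
    Uq ω →ₐ[ℂ] B :=
  have hpq' : ∀ y, p * (q * y) = y := fun y => by rw [← mul_assoc, hpq, one_mul]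
  have hqp' : ∀ y, q * (p * y) = y := fun y => by rw [← mul_assoc, hqp, one_mul]
  have hzp' : ∀ y, z * (p * y) = p * (z * y) := fun y => by rw [← mul_assoc, hzp, mul_assoc]
  have hzq' : ∀ y, z * (q * y) = q * (z * y) := fun y => by rw [← mul_assoc, hzq, mul_assoc]
  have hp' : ∀ x y, r x * (p * y) = p * (r x * y) := fun x y => by
    rw [← mul_assoc, hp, mul_assoc]
  have hq' : ∀ x y, r x * (q * y) = q * (r x * y) := fun x y => by
    rw [← mul_assoc, hq, mul_assoc]
  have hz' : ∀ x y, r x * (z * y) = z * (r x * y) := fun x y => by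
    rw [← mul_assoc, hz, mul_assoc]
  -- Since p, q, z centralize the image of r, the image of a central x commutes with every twisted
  -- generator; this serves both H and K.
  have hcomm : ∀ x : Uq ω, (∀ y, x * y = y * x) → ∀ g,
      r x * twistGen r p q z g = twistGen r p q z g * r x := by
    intro x hx g
    have hx' : ∀ y, r x * r y = r y * r x := fun y => by rw [← map_mul, hx, map_mul]
    cases g <;> simp only [twistGen, mul_add, add_mul, smul_mul_assoc, mul_smul_comm, mul_assoc,
      hp', hq', hz', hx']
  lift (twistGen r p q z)
    (by
      have hb : r (brH ω) = ω⁻¹ • (r (gen ω .K) ^ 2 - r (gen ω .Kinv) ^ 2) := by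
        rw [brH_eq, map_smul, map_sub, map_pow, map_pow]
      -- The term added to A† is a multiple of the central element u = K⁻¹[H], so it contributes
      -- nothing to [A, A†]; the scalings cancel by pq = 1.
      have hu := Kinv_mul_brH_comm (A ω)
      simp only [twistGen]
      rw [← hb]
      generalize gen ω .Kinv * brH ω = u at *
      simp only [mul_add, add_mul, smul_mul_assoc, mul_smul_comm, mul_assoc,
        hp', hq', hz', hzp', hpq', hqp', ← map_mul, hu, A_mul_Ad, map_add]
      abel)
    (by
      simp only [twistGen, mul_add, add_mul, smul_mul_assoc, mul_smul_comm, mul_assoc,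
        hp', hz', hzp', ← map_mul, N_mul_A, map_sub, mul_sub]
      rw [A_mul_Kinv_mul_A, mul_assoc]
      abel)
    (by
      -- The correction to N, bracketed with A†, yields K⁻¹[H]. This supplies precisely the extra
      -- term that the twisted A† carries on the right of [N, A†] = A†.
      have h := Kinv_mul_A_mul_Ad (ω := ω)
      have h' := (Kinv_mul_brH_comm (gen ω .Kinv * A ω)).symm
      have h'' := Kinv_mul_brH_comm (N ω)
      simp only [twistGen]
      generalize gen ω .Kinv * A ω = v at *
      generalize gen ω .Kinv * brH ω = u at *
      simp only [mul_add, add_mul, smul_mul_assoc, mul_smul_comm, mul_assoc,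
        hq', hz', hzq', ← map_mul, N_mul_Ad, map_add, h, h', h'', smul_add]
      abel)
    (by intro g; simpa only [twistGen] using hcomm _ H_comm g)
    (by intro g; simpa only [twistGen] using hcomm (gen ω .K) K_comm g)
    (by simp only [twistGen, ← map_mul, gen_K_mul_gen_Kinv, map_one])
    (by simp only [twistGen, ← map_mul, gen_Kinv_mul_gen_K, map_one])

theorem twist_gen (hpq hqp hzp hzq hp hq hz) (g : Gen) :
    twist r p q z hpq hqp hzp hzq hp hq hz (gen ω g) = twistGen r p q z g := by
  rw [twist, lift_gen]

theorem twist_brH (hpq hqp hzp hzq hp hq hz) :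
    twist r p q z hpq hqp hzp hzq hp hq hz (brH ω) = r (brH ω) := by
  simp only [brH_eq, map_smul, map_sub, map_pow, twist_gen, twistGen]

end Twist

end Uq

/-! ### Exchange rule and universal property of the braided tensor product. -/

namespace ModAlg

variable {ω : ℂ} (X Y : ModAlg ω)

namespace BTensor

/-- The elementary tensors `a ⊗ b` of the braided tensor product. -/
def mk : X.carrier →ₗ[ℂ] Y.carrier →ₗ[ℂ] BTensor X Y := TensorProduct.mk ℂ X.carrier Y.carrier

theorem mk_mul_mk (a c : X.carrier) {b : Y.carrier} (d : Y.carrier) {n : ℕ}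
    (hn : (Y.act (Uq.A ω) ^ n) b = 0) :
    mk X Y a b * mk X Y c d = ∑ k ∈ Finset.range n, (ω ^ k * (k.factorial : ℂ)⁻¹) •
      mk X Y (a * (X.act (Uq.Ad ω) ^ k) c) ((Y.act (Uq.A ω) ^ k) b * d) :=
  braidedMul_tmul_eq_sum X Y a c d hn

theorem mk_mul_mk_of_act_A (a c : X.carrier) {b : Y.carrier} (d : Y.carrier)
    (hb : Y.act (Uq.A ω) b = 0) : mk X Y a b * mk X Y c d = mk X Y (a * c) (b * d) := by
  rw [mk_mul_mk X Y a c d (n := 1) (by rwa [pow_one])]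
  simp

/-- Here the series is cut by the left factor: each term with k ≥ 1 applies a positive power of A†
to c. -/
theorem mk_mul_mk_of_act_Ad (a : X.carrier) {c : X.carrier} (b d : Y.carrier)
    (hc : X.act (Uq.Ad ω) c = 0) : mk X Y a b * mk X Y c d = mk X Y (a * c) (b * d) := by
  obtain ⟨n, hn⟩ := Y.act_A_locNil b
  -- The bound is raised to n + 1 so that the term k = 0 can be split off even when n = 0.
  rw [mk_mul_mk X Y a c d (pow_apply_eq_zero_of_le (Nat.le_succ n) hn),
    Finset.sum_range_succ', Finset.sum_eq_zero]
  · simp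
  · intro k _
    rw [pow_succ (X.act (Uq.Ad ω)), Module.End.mul_apply, hc]
    simp

/-- The inclusion `a ↦ a ⊗ 1` of the left factor. -/
def inl : X.carrier →ₐ[ℂ] BTensor X Y :=
  AlgHom.ofLinearMap ((mk X Y).flip 1) rfl fun a c => by
    simp only [LinearMap.flip_apply, mk_mul_mk_of_act_A X Y a c 1 (act_A_one Y), one_mul]

/-- The inclusion `b ↦ 1 ⊗ b` of the right factor. -/
def inr : Y.carrier →ₐ[ℂ] BTensor X Y :=
  AlgHom.ofLinearMap (mk X Y 1) rfl fun b d => by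
    rw [mk_mul_mk_of_act_Ad X Y 1 b d (act_Ad_one X), one_mul]

theorem inl_apply (a : X.carrier) : inl X Y a = mk X Y a 1 := rfl

theorem inr_apply (b : Y.carrier) : inr X Y b = mk X Y 1 b := rfl

theorem inl_mul_inr (a : X.carrier) (b : Y.carrier) :
    inl X Y a * inr X Y b = mk X Y a b := by
  rw [inl_apply, inr_apply, mk_mul_mk_of_act_A X Y a 1 b (act_A_one Y), one_mul, mul_one]

variable {X Y} in
theorem induction {P : BTensor X Y → Prop} (h : ∀ a b, P (inl X Y a * inr X Y b))
    (hadd : ∀ u v, P u → P v → P (u + v)) (u : BTensor X Y) : P u := by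
  refine TensorProduct.induction_on (motive := P) u ?_ (fun a b => ?_) hadd
  · have := h 0 0
    rw [map_zero, zero_mul] at this
    exact this
  · have := h a b
    rw [inl_mul_inr] at this
    exact this

/-- The exchange rule of the braided tensor product. -/
theorem inr_mul_inl {b : Y.carrier} (hb : Y.act (Uq.A ω) (Y.act (Uq.A ω) b) = 0) (c : X.carrier) :
    inr X Y b * inl X Y c = inl X Y c * inr X Y b
      + ω • (inl X Y (X.act (Uq.Ad ω) c) * inr X Y (Y.act (Uq.A ω) b)) := by
  rw [inl_mul_inr, inl_mul_inr, inl_apply, inr_apply,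
    mk_mul_mk X Y 1 c 1 (n := 2) (by rw [pow_two]; exact hb)]
  simp [Finset.sum_range_succ]

theorem inr_mul_inl_of_act_A {b : Y.carrier} (hb : Y.act (Uq.A ω) b = 0) (c : X.carrier) :
    inr X Y b * inl X Y c = inl X Y c * inr X Y b := by
  rw [inr_mul_inl X Y (by rw [hb, map_zero]), hb]
  simp

theorem inr_mul_inl_of_act_Ad (b : Y.carrier) {c : X.carrier} (hc : X.act (Uq.Ad ω) c = 0) :
    inr X Y b * inl X Y c = inl X Y c * inr X Y b := by
  rw [inl_mul_inr, inl_apply, inr_apply, mk_mul_mk_of_act_Ad X Y 1 b 1 hc, one_mul, mul_one]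

theorem act_Ad_inl (a : X.carrier) :
    BTensor.act X Y (Uq.Ad ω) (inl X Y a) = inl X Y (X.act (Uq.Ad ω) a) := by
  change tensorAct X.act Y.act (Uq.Ad ω) (a ⊗ₜ 1) = (X.act (Uq.Ad ω) a) ⊗ₜ[ℂ] 1
  rw [tensorAct_Ad]
  simp [act_Ad_one]

theorem act_Ad_inr (b : Y.carrier) :
    BTensor.act X Y (Uq.Ad ω) (inr X Y b) = inr X Y (Y.act (Uq.Ad ω) b) := by
  change tensorAct X.act Y.act (Uq.Ad ω) (1 ⊗ₜ b) = 1 ⊗ₜ[ℂ] (Y.act (Uq.Ad ω) b)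
  rw [tensorAct_Ad]
  simp [act_Ad_one]

/-- The linear map `a ⊗ b ↦ f a * g b`. -/
def liftLinear {B : Type*} [Ring B] [Algebra ℂ B] (f : X.carrier →ₐ[ℂ] B) (g : Y.carrier →ₐ[ℂ] B) :
    BTensor X Y →ₗ[ℂ] B :=
  LinearMap.mul' ℂ B ∘ₗ TensorProduct.map f.toLinearMap g.toLinearMap

section Lift

variable {X Y} {B : Type*} [Ring B] [Algebra ℂ B] (f : X.carrier →ₐ[ℂ] B) (g : Y.carrier →ₐ[ℂ] B)

theorem liftLinear_inl_mul_inr (a : X.carrier) (b : Y.carrier) :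
    liftLinear X Y f g (inl X Y a * inr X Y b) = f a * g b := by
  rw [inl_mul_inr]
  rfl

theorem liftLinear_mul_inr (u : BTensor X Y) (b : Y.carrier) :
    liftLinear X Y f g (u * inr X Y b) = liftLinear X Y f g u * g b := by
  induction u using BTensor.induction with
  | h a c => rw [mul_assoc, ← map_mul, liftLinear_inl_mul_inr, liftLinear_inl_mul_inr, map_mul,
      mul_assoc]
  | hadd u v hu hv => rw [add_mul, map_add, hu, hv, map_add, add_mul]

theorem liftLinear_inl_mul (a : X.carrier) (u : BTensor X Y) :
    liftLinear X Y f g (inl X Y a * u) = f a * liftLinear X Y f g u := by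
  induction u using BTensor.induction with
  | h c b => rw [← mul_assoc, ← map_mul, liftLinear_inl_mul_inr, liftLinear_inl_mul_inr, map_mul,
      mul_assoc]
  | hadd u v hu hv => rw [mul_add, map_add, hu, hv, map_add, mul_add]

/-- Compatibility with the exchange rule passes to products in the right factor, so it has to be
checked on generators only. -/
theorem liftLinear_inr_mul_inl_mul {b b' : Y.carrier}
    (hb : ∀ c, liftLinear X Y f g (inr X Y b * inl X Y c) = g b * f c)
    (hb' : ∀ c, liftLinear X Y f g (inr X Y b' * inl X Y c) = g b' * f c) (c : X.carrier) :
    liftLinear X Y f g (inr X Y (b * b') * inl X Y c) = g (b * b') * f c := by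
  have key : ∀ u : BTensor X Y,
      liftLinear X Y f g (inr X Y b * u) = g b * liftLinear X Y f g u := by
    intro u
    induction u using BTensor.induction with
    | h a d => rw [← mul_assoc, liftLinear_mul_inr, hb, liftLinear_inl_mul_inr, mul_assoc]
    | hadd u v hu hv => rw [mul_add, map_add, hu, hv, map_add, mul_add]
  rw [map_mul (inr X Y), mul_assoc, key, hb', map_mul, mul_assoc]

/-- Outer factors from X on the left and from Y on the right always come out of the map. In a
product of two elementary tensors only the inner pair, in the wrong order, remains, and that is the
hypothesis. -/
theorem liftLinear_mul
    (h : ∀ b c, liftLinear X Y f g (inr X Y b * inl X Y c) = g b * f c) (u v : BTensor X Y) :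
    liftLinear X Y f g (u * v) = liftLinear X Y f g u * liftLinear X Y f g v := by
  induction v using BTensor.induction with
  | h c d =>
    rw [← mul_assoc, liftLinear_mul_inr, liftLinear_inl_mul_inr, ← mul_assoc]
    congr 1
    induction u using BTensor.induction with
    | h a b => rw [mul_assoc, liftLinear_inl_mul, h, liftLinear_inl_mul_inr, mul_assoc]
    | hadd u v hu hv => rw [add_mul, map_add, hu, hv, map_add, add_mul]
  | hadd v w hv hw => rw [mul_add, map_add, hv, hw, map_add, mul_add]

/-- The algebra homomorphism `a ⊗ b ↦ f a * g b` out of the braided tensor product, for `f` and `g`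
compatible with the exchange rule. -/
def lift (h : ∀ b c, liftLinear X Y f g (inr X Y b * inl X Y c) = g b * f c) :
    BTensor X Y →ₐ[ℂ] B :=
  AlgHom.ofLinearMap (liftLinear X Y f g)
    (by simpa only [map_one, mul_one] using liftLinear_inl_mul_inr f g 1 1)
    (liftLinear_mul f g h)

theorem lift_inl (h) (a : X.carrier) : lift f g h (inl X Y a) = f a := by
  have e := liftLinear_inl_mul_inr f g a 1
  rw [map_one, mul_one, map_one, mul_one] at e
  exact e

theorem lift_inr (h) (b : Y.carrier) : lift f g h (inr X Y b) = g b := by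
  have e := liftLinear_inl_mul_inr f g 1 b
  rw [map_one, one_mul, map_one, one_mul] at e
  exact e

theorem algHom_ext {f g : BTensor X Y →ₐ[ℂ] B} (hl : ∀ a, f (inl X Y a) = g (inl X Y a))
    (hr : ∀ b, f (inr X Y b) = g (inr X Y b)) : f = g := by
  ext u
  induction u using BTensor.induction with
  | h a b => rw [map_mul, map_mul, hl, hr]
  | hadd u v hu hv => rw [map_add, map_add, hu, hv]

end Lift

end BTensor

end ModAlg

end BraidedHeisenberg

end

noncomputable section

namespace BraidedHeisenberg

/-! ### The exchange rule with `BU_q(h)` as right factor. -/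

namespace Uq

variable (ω : ℂ)

theorem adjoint_A_of_commute {x : Uq ω} (h : A ω * x = x * A ω) : adjoint ω (A ω) x = 0 := by
  rw [adjoint_A, h, sub_self, mul_zero]

/-- A† and N are the only generators not commuting with A. The values of A on them are again killed
by A, so their exchange rules have a single correction term. -/
theorem adjoint_A_Ad : adjoint ω (A ω) (Ad ω) = gen ω .Kinv * brH ω := by
  rw [adjoint_A, A_mul_Ad, add_sub_cancel_left]

theorem adjoint_A_N : adjoint ω (A ω) (N ω) = gen ω .Kinv * A ω := by
  rw [adjoint_A, N_mul_A, sub_sub_cancel]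

theorem adjoint_A_central {x : Uq ω} (h : ∀ y, x * y = y * x) : adjoint ω (A ω) x = 0 :=
  adjoint_A_of_commute ω (h _).symm

end Uq

namespace ModAlg

variable {ω : ℂ} (X : ModAlg ω)

namespace BTensor

/-- The inclusion of the right factor `BU_q(h)`, as a homomorphism out of `U_q(h)`. -/
def inrUq : Uq ω →ₐ[ℂ] BTensor X (BUq ω) := inr X (BUq ω)

theorem inrUq_mul_inl_of_commute {x : Uq ω} (hx : Uq.A ω * x = x * Uq.A ω) (c : X.carrier) :
    inrUq X x * inl X (BUq ω) c = inl X (BUq ω) c * inrUq X x :=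
  inr_mul_inl_of_act_A X (BUq ω) (Uq.adjoint_A_of_commute ω hx) c

theorem inrUq_mul_inl_of_central {x : Uq ω} (hx : ∀ y, x * y = y * x) (c : X.carrier) :
    inrUq X x * inl X (BUq ω) c = inl X (BUq ω) c * inrUq X x :=
  inrUq_mul_inl_of_commute X (hx _).symm c

theorem inrUq_mul_inl_of_act_Ad (x : Uq ω) {c : X.carrier} (hc : X.act (Uq.Ad ω) c = 0) :
    inrUq X x * inl X (BUq ω) c = inl X (BUq ω) c * inrUq X x :=
  inr_mul_inl_of_act_Ad X (BUq ω) x hc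

theorem inrUq_Ad_mul_inl (c : X.carrier) :
    inrUq X (Uq.Ad ω) * inl X (BUq ω) c = inl X (BUq ω) c * inrUq X (Uq.Ad ω)
      + ω • (inl X (BUq ω) (X.act (Uq.Ad ω) c) * inrUq X (Uq.gen ω .Kinv * Uq.brH ω)) := by
  have e := inr_mul_inl X (BUq ω) (b := Uq.Ad ω) (Uq.adjoint_A_Ad ω ▸
    Uq.adjoint_A_central ω Uq.Kinv_mul_brH_comm) c
  rw [Uq.adjoint_A_Ad] at e
  exact e

theorem inrUq_N_mul_inl (c : X.carrier) :
    inrUq X (Uq.N ω) * inl X (BUq ω) c = inl X (BUq ω) c * inrUq X (Uq.N ω)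
      + ω • (inl X (BUq ω) (X.act (Uq.Ad ω) c) * inrUq X (Uq.gen ω .Kinv * Uq.A ω)) := by
  have e := inr_mul_inl X (BUq ω) (b := Uq.N ω) (Uq.adjoint_A_N ω ▸
    Uq.adjoint_A_of_commute ω Uq.A_mul_Kinv_mul_A) c
  rw [Uq.adjoint_A_N] at e
  exact e

end BTensor

/-- Because k commutes with c, the exchange error r[z,c]k is the commutator of rzk with c, and
subtracting rzk from x removes it. It is used for x = A† with k = K⁻¹[H] and for x = N with k =
K⁻¹A. -/
theorem commute_of_exchange {S : Type*} [Ring S] [Algebra ℂ S] {r : ℂ} {c k x z : S}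
    (hx : x * c = c * x + r • ((z * c - c * z) * k)) (hk : k * c = c * k) :
    Commute c (x + r • (-z * k)) := by
  rw [Commute, SemiconjBy, mul_add, add_mul, hx, mul_smul_comm, smul_mul_assoc, mul_assoc (-z), hk,
    add_assoc, ← smul_add]
  congr 2
  noncomm_ring

/-! ### Inner actions of A† and the copy of U_q(h) centralizing X. -/

/-- The action of `A†` on `X` is the commutator with `Z`, and `W` is a central unit of `X`. -/
structure IsInner (Z : X.carrier) (W : X.carrierˣ) : Prop where
  act_Ad (c : X.carrier) : X.act (Uq.Ad ω) c = Z * c - c * Z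
  comm (c : X.carrier) : W * c = c * W

namespace IsInner

open BTensor

variable {X} {Z : X.carrier} {W : X.carrierˣ}

theorem inv_comm (h : IsInner X Z W) (c : X.carrier) :
    ((W⁻¹ : X.carrierˣ) : X.carrier) * c = c * (W⁻¹ : X.carrierˣ) :=
  (show Commute (W : X.carrier) c from h.comm c).units_inv_left

/-- Elements of X killed by A† commute with the whole right factor. For Z, W and W⁻¹ this is what
makes them admissible data for `Uq.twist`. -/
theorem act_Ad_Z (h : IsInner X Z W) : X.act (Uq.Ad ω) Z = 0 := by rw [h.act_Ad, sub_self]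

theorem act_Ad_W (h : IsInner X Z W) : X.act (Uq.Ad ω) W = 0 := by rw [h.act_Ad, h.comm, sub_self]

theorem act_Ad_W_inv (h : IsInner X Z W) : X.act (Uq.Ad ω) (W⁻¹ : X.carrierˣ) = 0 := by
  rw [h.act_Ad, h.inv_comm, sub_self]

/-- The copy of `U_q(h)` in the braided tensor product that centralizes the left factor. -/
def toBTensor (h : IsInner X Z W) : Uq ω →ₐ[ℂ] BTensor X (BUq ω) :=
  -- The sign of Z is what cancels the exchange errors; W only fixes the normalization of A and A†.
  Uq.twist (inrUq X) (inl X (BUq ω) (W⁻¹ : X.carrierˣ)) (inl X (BUq ω) W) (-inl X (BUq ω) Z)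
    (by rw [← map_mul, Units.inv_mul, map_one])
    (by rw [← map_mul, Units.mul_inv, map_one])
    (by rw [neg_mul, mul_neg, ← map_mul, ← map_mul, h.inv_comm])
    (by rw [neg_mul, mul_neg, ← map_mul, ← map_mul, h.comm])
    (fun x => inrUq_mul_inl_of_act_Ad X x h.act_Ad_W_inv)
    (fun x => inrUq_mul_inl_of_act_Ad X x h.act_Ad_W)
    (fun x => by rw [neg_mul, mul_neg, inrUq_mul_inl_of_act_Ad X x h.act_Ad_Z])

theorem toBTensor_gen (h : IsInner X Z W) (g : Gen) : h.toBTensor (Uq.gen ω g)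
    = Uq.twistGen (inrUq X) (inl X (BUq ω) (W⁻¹ : X.carrierˣ)) (inl X (BUq ω) W)
      (-inl X (BUq ω) Z) g :=
  Uq.twist_gen _ _ _ _ _ _ _ _ _ _ _ _

theorem toBTensor_A (h : IsInner X Z W) : h.toBTensor (Uq.A ω)
    = inl X (BUq ω) (W⁻¹ : X.carrierˣ) * inrUq X (Uq.A ω) := h.toBTensor_gen _

theorem toBTensor_Ad (h : IsInner X Z W) : h.toBTensor (Uq.Ad ω) = inl X (BUq ω) W *
    (inrUq X (Uq.Ad ω) - ω • (inl X (BUq ω) Z * inrUq X (Uq.gen ω .Kinv * Uq.brH ω))) := by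
  rw [toBTensor_gen, Uq.twistGen, neg_mul, smul_neg, sub_eq_add_neg]

theorem toBTensor_N (h : IsInner X Z W) : h.toBTensor (Uq.N ω)
    = inrUq X (Uq.N ω) - ω • (inl X (BUq ω) Z * inrUq X (Uq.gen ω .Kinv * Uq.A ω)) := by
  rw [toBTensor_gen, Uq.twistGen, neg_mul, smul_neg, sub_eq_add_neg]

theorem toBTensor_H (h : IsInner X Z W) : h.toBTensor (Uq.H ω) = inrUq X (Uq.H ω) :=
  h.toBTensor_gen _

theorem toBTensor_K (h : IsInner X Z W) : h.toBTensor (Uq.gen ω .K) = inrUq X (Uq.gen ω .K) :=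
  h.toBTensor_gen _

theorem toBTensor_Kinv (h : IsInner X Z W) :
    h.toBTensor (Uq.gen ω .Kinv) = inrUq X (Uq.gen ω .Kinv) :=
  h.toBTensor_gen _

theorem toBTensor_brH (h : IsInner X Z W) : h.toBTensor (Uq.brH ω) = inrUq X (Uq.brH ω) := by
  rw [toBTensor, Uq.twist_brH]

theorem toBTensor_Kinv_mul_A (h : IsInner X Z W) : h.toBTensor (Uq.gen ω .Kinv * Uq.A ω)
    = inl X (BUq ω) (W⁻¹ : X.carrierˣ) * inrUq X (Uq.gen ω .Kinv * Uq.A ω) := by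
  rw [map_mul, toBTensor_Kinv, toBTensor_A, ← mul_assoc,
    inrUq_mul_inl_of_act_Ad X _ h.act_Ad_W_inv, mul_assoc, ← map_mul]

/-- Only A† and N need their corrections (`commute_of_exchange`): A, H and K^{±1} are killed by A
and hence pass c unchanged, and the scalings are central in X. -/
theorem inl_comm_toBTensor (h : IsInner X Z W) (c : X.carrier) (x : Uq ω) :
    Commute (inl X (BUq ω) c) (h.toBTensor x) := by
  have hW : Commute (inl X (BUq ω) c) (inl X (BUq ω) W) := by
    rw [Commute, SemiconjBy, ← map_mul, ← map_mul, h.comm]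
  have hW' : Commute (inl X (BUq ω) c) (inl X (BUq ω) (W⁻¹ : X.carrierˣ)) := by
    rw [Commute, SemiconjBy, ← map_mul, ← map_mul, h.inv_comm]
  induction x using Uq.gen_induction with
  | hg g =>
    rw [toBTensor_gen]
    cases g
    · exact hW'.mul_right (inrUq_mul_inl_of_commute X rfl c).symm
    · refine hW.mul_right (commute_of_exchange ?_ (inrUq_mul_inl_of_central X
        Uq.Kinv_mul_brH_comm c))
      rw [inrUq_Ad_mul_inl, h.act_Ad, map_sub, map_mul (inl X (BUq ω)), map_mul (inl X (BUq ω))]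
    · refine commute_of_exchange ?_ (inrUq_mul_inl_of_commute X Uq.A_mul_Kinv_mul_A c)
      rw [inrUq_N_mul_inl, h.act_Ad, map_sub, map_mul (inl X (BUq ω)), map_mul (inl X (BUq ω))]
    · exact (inrUq_mul_inl_of_central X Uq.H_comm c).symm
    · exact (inrUq_mul_inl_of_central X Uq.K_comm c).symm
    · exact (inrUq_mul_inl_of_central X Uq.Kinv_comm c).symm
  | hc r => rw [AlgHom.commutes]; exact Algebra.commute_algebraMap_right r _
  | ha x y hx hy => rw [map_add]; exact hx.add_right hy
  | hm x y hx hy => rw [map_mul]; exact hx.mul_right hy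

/-! ### The isomorphism of X ⊗̲ BU_q(h) with X ⊗ U_q(h). -/

/-- The map from the ordinary to the braided tensor product. -/
def ofTensor (h : IsInner X Z W) : X.carrier ⊗[ℂ] Uq ω →ₐ[ℂ] BTensor X (BUq ω) :=
  Algebra.TensorProduct.lift (inl X (BUq ω)) h.toBTensor h.inl_comm_toBTensor

/-- The copy in the ordinary tensor product of the right factor of the braided one. -/
def toTensor (h : IsInner X Z W) : Uq ω →ₐ[ℂ] X.carrier ⊗[ℂ] Uq ω :=
  -- Solving the formulas of `toBTensor` for the original generators gives A = W A', A† = W⁻¹A†' +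
  -- ωZK⁻¹[H] and N = N' + ωZK⁻¹A = N' + ωWZK⁻¹A'. This is the twist with p = W, q = W⁻¹, z = WZ,
  -- where qz = Z.
  Uq.twist Algebra.TensorProduct.includeRight ((W : X.carrier) ⊗ₜ 1)
    (((W⁻¹ : X.carrierˣ) : X.carrier) ⊗ₜ 1) ((W * Z) ⊗ₜ 1)
    (by simp [Algebra.TensorProduct.one_def]) (by simp [Algebra.TensorProduct.one_def])
    (by rw [Algebra.TensorProduct.tmul_mul_tmul, Algebra.TensorProduct.tmul_mul_tmul,
      h.comm (W * Z)])
    (by rw [Algebra.TensorProduct.tmul_mul_tmul, Algebra.TensorProduct.tmul_mul_tmul, h.inv_comm])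
    (by simp) (by simp) (by simp)

theorem toTensor_gen (h : IsInner X Z W) (g : Gen) : h.toTensor (Uq.gen ω g)
    = Uq.twistGen Algebra.TensorProduct.includeRight ((W : X.carrier) ⊗ₜ 1)
    (((W⁻¹ : X.carrierˣ) : X.carrier) ⊗ₜ 1) ((W * Z) ⊗ₜ 1) g := by
  rw [toTensor, Uq.twist_gen]

theorem toTensor_A (h : IsInner X Z W) : h.toTensor (Uq.A ω) = (W : X.carrier) ⊗ₜ Uq.A ω := by
  rw [toTensor_gen]
  simp [Uq.twistGen]

theorem toTensor_Ad (h : IsInner X Z W) : h.toTensor (Uq.Ad ω)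
    = ((W⁻¹ : X.carrierˣ) : X.carrier) ⊗ₜ Uq.Ad ω
      + ω • (Z ⊗ₜ (Uq.gen ω .Kinv * Uq.brH ω)) := by
  rw [toTensor_gen]
  simp [Uq.twistGen, mul_add]

theorem toTensor_N (h : IsInner X Z W) : h.toTensor (Uq.N ω)
    = 1 ⊗ₜ Uq.N ω + ω • ((W * Z) ⊗ₜ (Uq.gen ω .Kinv * Uq.A ω)) := by
  rw [toTensor_gen]
  simp [Uq.twistGen]

theorem toTensor_H (h : IsInner X Z W) : h.toTensor (Uq.H ω) = 1 ⊗ₜ Uq.H ω := h.toTensor_gen _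

theorem toTensor_K (h : IsInner X Z W) : h.toTensor (Uq.gen ω .K) = 1 ⊗ₜ Uq.gen ω .K :=
  h.toTensor_gen _

theorem toTensor_Kinv (h : IsInner X Z W) : h.toTensor (Uq.gen ω .Kinv) = 1 ⊗ₜ Uq.gen ω .Kinv :=
  h.toTensor_gen _

theorem toTensor_brH (h : IsInner X Z W) : h.toTensor (Uq.brH ω) = 1 ⊗ₜ Uq.brH ω := by
  rw [toTensor, Uq.twist_brH]
  rfl

/-- In the ordinary product, c ⊗ 1 fails to commute with the images of A† and N only through Z, and
the resulting [Z,c] = A† ▷ c reproduces the exchange rule. -/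
theorem liftLinear_inrUq_mul_inl (h : IsInner X Z W) (b : Uq ω) (c : X.carrier) :
    liftLinear X (BUq ω) Algebra.TensorProduct.includeLeft h.toTensor (inrUq X b * inl X (BUq ω) c)
      = h.toTensor b * (c ⊗ₜ[ℂ] 1) := by
  have hL : ∀ (a : X.carrier) (x : Uq ω), liftLinear X (BUq ω) Algebra.TensorProduct.includeLeft
      h.toTensor (inl X (BUq ω) a * inrUq X x) = (a ⊗ₜ 1) * h.toTensor x :=
    liftLinear_inl_mul_inr (X := X) (Y := BUq ω) Algebra.TensorProduct.includeLeft h.toTensor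
  have hcen : ∀ x : Uq ω, (∀ y, x * y = y * x) → h.toTensor x = 1 ⊗ₜ x → ∀ c : X.carrier,
      liftLinear X (BUq ω) Algebra.TensorProduct.includeLeft h.toTensor
        (inrUq X x * inl X (BUq ω) c) = h.toTensor x * (c ⊗ₜ[ℂ] 1) := by
    intro x hx e c
    rw [inrUq_mul_inl_of_central X hx, hL, e, Algebra.TensorProduct.tmul_mul_tmul,
      Algebra.TensorProduct.tmul_mul_tmul]
    simp only [one_mul, mul_one]
  induction b using Uq.gen_induction generalizing c with
  | hg g =>
    cases g
    · rw [inrUq_mul_inl_of_commute X rfl, hL, toTensor_A]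
      simp [h.comm c]
    · rw [inrUq_Ad_mul_inl, map_add, map_smul, hL, hL, h.act_Ad, map_mul, toTensor_Kinv,
        toTensor_brH, toTensor_Ad]
      simp only [mul_add, add_mul, mul_smul_comm, smul_mul_assoc,
        Algebra.TensorProduct.tmul_mul_tmul, one_mul, mul_one, h.inv_comm c, add_assoc, ← smul_add,
        ← TensorProduct.add_tmul, add_sub_cancel]
    · rw [inrUq_N_mul_inl, map_add, map_smul, hL, hL, h.act_Ad, map_mul, toTensor_Kinv,
        toTensor_A, toTensor_N]
      simp only [mul_add, add_mul, mul_smul_comm, smul_mul_assoc,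
        Algebra.TensorProduct.tmul_mul_tmul, one_mul, mul_one, add_assoc, ← smul_add,
        ← TensorProduct.add_tmul]
      -- Centrality of W turns c(WZ) + (Zc - cZ)W into WZc.
      rw [← h.comm (_ - _), mul_sub, ← mul_assoc c, ← h.comm c, mul_assoc, mul_assoc,
        add_sub_cancel]
    · exact hcen _ Uq.H_comm (h.toTensor_gen _) c
    · exact hcen _ Uq.K_comm (h.toTensor_gen _) c
    · exact hcen _ Uq.Kinv_comm (h.toTensor_gen _) c
  | hc r =>
    refine hcen _ (fun y => Algebra.commutes r y) ?_ c
    rw [AlgHom.commutes, Algebra.algebraMap_eq_smul_one, Algebra.algebraMap_eq_smul_one,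
      TensorProduct.tmul_smul]
    rfl
  | ha x y hx hy => rw [map_add (inrUq X), add_mul, map_add, hx, hy, map_add, add_mul]
  | hm x y hx hy =>
    exact liftLinear_inr_mul_inl_mul (X := X) (Y := BUq ω) Algebra.TensorProduct.includeLeft
      h.toTensor (b := x) (b' := y) hx hy c

/-- The map from the braided to the ordinary tensor product. -/
def ofBTensor (h : IsInner X Z W) : BTensor X (BUq ω) →ₐ[ℂ] X.carrier ⊗[ℂ] Uq ω :=
  lift Algebra.TensorProduct.includeLeft h.toTensor h.liftLinear_inrUq_mul_inl

theorem ofBTensor_inl (h : IsInner X Z W) (c : X.carrier) : h.ofBTensor (inl X (BUq ω) c) = c ⊗ₜ 1 :=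
  lift_inl (X := X) (Y := BUq ω) _ _ h.liftLinear_inrUq_mul_inl c

theorem ofBTensor_inr (h : IsInner X Z W) (b : Uq ω) : h.ofBTensor (inrUq X b) = h.toTensor b :=
  lift_inr (X := X) (Y := BUq ω) Algebra.TensorProduct.includeLeft h.toTensor
    h.liftLinear_inrUq_mul_inl b

theorem ofTensor_tmul (h : IsInner X Z W) (c : X.carrier) (b : Uq ω) :
    h.ofTensor (c ⊗ₜ b) = inl X (BUq ω) c * h.toBTensor b :=
  Algebra.TensorProduct.lift_tmul _ _ _ _ _

theorem ofTensor_comp_toTensor (h : IsInner X Z W) : h.ofTensor.comp h.toTensor = inrUq X := by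
  apply Uq.algHom_ext
  · rw [AlgHom.comp_apply, toTensor_A, ofTensor_tmul, toBTensor_A, ← mul_assoc, ← map_mul,
      Units.mul_inv, map_one, one_mul]
  · rw [AlgHom.comp_apply, toTensor_Ad, map_add, map_smul, ofTensor_tmul, ofTensor_tmul,
      toBTensor_Ad, ← mul_assoc, ← map_mul, Units.inv_mul, map_one, one_mul, map_mul h.toBTensor,
      toBTensor_Kinv, toBTensor_brH, ← map_mul, sub_add_cancel]
  · rw [AlgHom.comp_apply, toTensor_N, map_add, map_smul, ofTensor_tmul, ofTensor_tmul,
      toBTensor_N, toBTensor_Kinv_mul_A, ← mul_assoc, ← map_mul, h.comm, mul_assoc,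
      Units.mul_inv, mul_one, map_one, one_mul, sub_add_cancel]
  · rw [AlgHom.comp_apply, toTensor_H, ofTensor_tmul, toBTensor_H, map_one, one_mul]
  · rw [AlgHom.comp_apply, toTensor_K, ofTensor_tmul, toBTensor_K, map_one, one_mul]

theorem ofBTensor_comp_toBTensor (h : IsInner X Z W) :
    h.ofBTensor.comp h.toBTensor = Algebra.TensorProduct.includeRight := by
  apply Uq.algHom_ext
  · rw [AlgHom.comp_apply, toBTensor_A, map_mul, ofBTensor_inl, ofBTensor_inr, toTensor_A]
    simp
  · rw [AlgHom.comp_apply, toBTensor_Ad, map_mul, map_sub, map_smul, map_mul, ofBTensor_inl,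
      ofBTensor_inl, ofBTensor_inr, ofBTensor_inr, map_mul, toTensor_Ad, toTensor_Kinv,
      toTensor_brH]
    simp
  · rw [AlgHom.comp_apply, toBTensor_N, map_sub, map_smul, map_mul, ofBTensor_inl, ofBTensor_inr,
      ofBTensor_inr, map_mul, toTensor_N, toTensor_Kinv, toTensor_A]
    simp [h.comm Z]
  · rw [AlgHom.comp_apply, toBTensor_H, ofBTensor_inr, toTensor_H]
    rfl
  · rw [AlgHom.comp_apply, toBTensor_K, ofBTensor_inr, toTensor_K]
    rfl

/-- The braided tensor product of `X` with `BU_q(h)` is isomorphic to the ordinary one. -/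
def equiv (h : IsInner X Z W) : BTensor X (BUq ω) ≃ₐ[ℂ] X.carrier ⊗[ℂ] Uq ω :=
  AlgEquiv.ofAlgHom h.ofBTensor h.ofTensor
    (by
      refine Algebra.TensorProduct.ext' fun c b => ?_
      rw [AlgHom.comp_apply, ofTensor_tmul, map_mul, ofBTensor_inl]
      have e := DFunLike.congr_fun h.ofBTensor_comp_toBTensor b
      rw [AlgHom.comp_apply] at e
      rw [e]
      simp)
    (by
      refine BTensor.algHom_ext (fun c => ?_) fun b => ?_
      · rw [AlgHom.comp_apply, ofBTensor_inl, ofTensor_tmul, map_one, mul_one]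
        rfl
      · change h.ofTensor (h.ofBTensor (inrUq X b)) = _
        rw [ofBTensor_inr]
        exact DFunLike.congr_fun h.ofTensor_comp_toTensor b)

theorem equiv_inl (h : IsInner X Z W) (c : X.carrier) : h.equiv (inl X (BUq ω) c) = c ⊗ₜ 1 :=
  h.ofBTensor_inl c

theorem equiv_toBTensor (h : IsInner X Z W) (b : Uq ω) : h.equiv (h.toBTensor b) = 1 ⊗ₜ b :=
  DFunLike.congr_fun h.ofBTensor_comp_toBTensor b

end IsInner

end ModAlg

end BraidedHeisenberg

end

noncomputable section

namespace BraidedHeisenberg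

/-! ### Powers of K, and the relation between M̄ and X̄†X̄. -/

namespace Uq

variable {ω : ℂ}

theorem K_zpow_comm (m : ℤ) (x : Uq ω) :
    ((K ω ^ m : (Uq ω)ˣ) : Uq ω) * x = x * ((K ω ^ m : (Uq ω)ˣ) : Uq ω) :=
  (show Commute ((K ω : (Uq ω)ˣ) : Uq ω) x from K_comm x).units_zpow_left m

theorem K_zpow_neg_one : ((K ω ^ (-1 : ℤ) : (Uq ω)ˣ) : Uq ω) = gen ω .Kinv := by
  rw [zpow_neg_one, gen_Kinv]

/-- This is ω[H] = K² - K⁻² multiplied by K⁻². It is the origin of the exponent -4 in `innerAd`. -/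
theorem K_zpow_add_smul (hω : ω ≠ 0) : ((K ω ^ (-4 : ℤ) : (Uq ω)ˣ) : Uq ω)
    + ω • (gen ω .Kinv * (gen ω .Kinv * brH ω)) = 1 := by
  rw [brH, ← mul_assoc, mul_smul_comm, smul_smul, mul_inv_cancel₀ hω, one_smul, ← K_zpow_neg_one,
    mul_sub, ← Units.val_mul, ← Units.val_mul, ← Units.val_mul, ← zpow_add, ← zpow_natCast,
    ← zpow_add, ← zpow_add]
  norm_num

end Uq

/-- In the product of the twisted A† and A the units W and W⁻¹ cancel. What remains besides A†A is
-ωZK⁻¹[H]A, which is [H] times the correction to N. -/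
theorem ModAlg.IsInner.inrUq_brH_mul {ω : ℂ} {X : ModAlg ω} {Z : X.carrier} {W : X.carrierˣ}
    (h : ModAlg.IsInner X Z W) :
    BTensor.inrUq X (Uq.brH ω) * (h.toBTensor (Uq.N ω) - BTensor.inrUq X (Uq.N ω))
      = h.toBTensor (Uq.Ad ω) * h.toBTensor (Uq.A ω)
        - BTensor.inrUq X (Uq.Ad ω) * BTensor.inrUq X (Uq.A ω) := by
  rw [h.toBTensor_A, ← mul_assoc, ← (h.inl_comm_toBTensor _ _).eq, h.toBTensor_Ad, ← mul_assoc,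
    ← map_mul, Units.inv_mul, map_one, one_mul, h.toBTensor_N, sub_mul, sub_sub_cancel_left,
    sub_sub_cancel_left, mul_neg, mul_smul_comm, smul_mul_assoc, ← mul_assoc,
    BTensor.inrUq_mul_inl_of_central X Uq.brH_comm, mul_assoc, mul_assoc, ← map_mul, ← map_mul,
    ← mul_assoc, Uq.brH_comm (Uq.gen ω .Kinv)]

/-! ### Places and central exponentials in the braided power. -/

namespace BUqTensor

variable {ω : ℂ} {n : ℕ}

/-- The inclusion of the first `n` factors. -/
def inl : BUqTensor ω n →ₐ[ℂ] BUqTensor ω (n + 1) :=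
  ModAlg.BTensor.inl (ModAlg.BUqPow ω n) (ModAlg.BUq ω)

/-- The inclusion of the last factor. -/
def inr : Uq ω →ₐ[ℂ] BUqTensor ω (n + 1) :=
  ModAlg.BTensor.inrUq (ModAlg.BUqPow ω n)

theorem induction_succ {P : BUqTensor ω (n + 1) → Prop} (h : ∀ a b, P (inl a * inr b))
    (hadd : ∀ u v, P u → P v → P (u + v)) (u : BUqTensor ω (n + 1)) : P u :=
  ModAlg.BTensor.induction (X := ModAlg.BUqPow ω n) (Y := ModAlg.BUq ω) (P := P) h hadd u

theorem inr_mul_inl_of_central {x : Uq ω} (hx : ∀ y, x * y = y * x) (c : BUqTensor ω n) :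
    inr x * inl c = inl c * inr x :=
  ModAlg.BTensor.inrUq_mul_inl_of_central (ModAlg.BUqPow ω n) hx c

theorem inr_mul_inl_of_act_Ad (x : Uq ω) {c : BUqTensor ω n}
    (hc : (ModAlg.BUqPow ω n).act (Uq.Ad ω) c = 0) : inr x * inl c = inl c * inr x :=
  ModAlg.BTensor.inrUq_mul_inl_of_act_Ad (ModAlg.BUqPow ω n) x hc

theorem inr_Ad_mul_inl (c : BUqTensor ω n) :
    inr (Uq.Ad ω) * inl c = inl c * inr (Uq.Ad ω)
      + ω • (inl ((ModAlg.BUqPow ω n).act (Uq.Ad ω) c) * inr (Uq.gen ω .Kinv * Uq.brH ω)) :=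
  ModAlg.BTensor.inrUq_Ad_mul_inl (ModAlg.BUqPow ω n) c

theorem act_Ad_inl (c : BUqTensor ω n) : (ModAlg.BUqPow ω (n + 1)).act (Uq.Ad ω) (inl c)
    = inl ((ModAlg.BUqPow ω n).act (Uq.Ad ω) c) :=
  ModAlg.BTensor.act_Ad_inl (ModAlg.BUqPow ω n) (ModAlg.BUq ω) c

theorem act_Ad_inr (x : Uq ω) : (ModAlg.BUqPow ω (n + 1)).act (Uq.Ad ω) (inr x)
    = inr (Uq.gen ω .Kinv * (Uq.Ad ω * x - x * Uq.Ad ω)) := by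
  rw [← Uq.adjoint_Ad]
  exact ModAlg.BTensor.act_Ad_inr (ModAlg.BUqPow ω n) (ModAlg.BUq ω) x

theorem pureTensor_succ (x : Fin (n + 1) → Uq ω) :
    pureTensor x = inl (pureTensor fun i => x i.castSucc) * inr (x (Fin.last n)) :=
  (ModAlg.BTensor.inl_mul_inr (ModAlg.BUqPow ω n) (ModAlg.BUq ω) _ _).symm

theorem pureTensor_one : pureTensor (fun _ => 1 : Fin n → Uq ω) = 1 := by
  induction n with
  | zero => rfl
  | succ n ih => rw [pureTensor_succ, ih, map_one, map_one, one_mul]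

theorem place_castSucc (i : Fin n) (x : Uq ω) : place i.castSucc x = inl (place i x) := by
  rw [place, pureTensor_succ, Pi.mulSingle_eq_of_ne (Fin.castSucc_lt_last i).ne', map_one, mul_one,
    place]
  congr 2
  ext j
  simp [Pi.mulSingle_apply]

theorem place_last (x : Uq ω) : place (Fin.last n) x = inr x := by
  rw [place, pureTensor_succ, Pi.mulSingle_eq_same]
  have h : (fun i : Fin n => Pi.mulSingle (M := fun _ => Uq ω) (Fin.last n) x i.castSucc)
      = fun _ => 1 := by
    ext i
    rw [Pi.mulSingle_eq_of_ne (Fin.castSucc_lt_last i).ne]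
  rw [h, pureTensor_one, map_one, one_mul]

theorem expH_succ (m : Fin (n + 1) → ℤ) : expH m
    = inl (expH fun i => m i.castSucc) * inr ((Uq.K ω ^ m (Fin.last n) : (Uq ω)ˣ) : Uq ω) :=
  pureTensor_succ _

theorem expH_zero : expH (0 : Fin n → ℤ) = (1 : BUqTensor ω n) := by
  rw [← pureTensor_one]
  simp [expH]

theorem expH_eq_inl {m : Fin (n + 1) → ℤ} {m' : Fin n → ℤ} (h : ∀ i, m i.castSucc = m' i)
    (h₀ : m (Fin.last n) = 0) : expH m = inl (expH (ω := ω) m') := by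
  rw [expH_succ, h₀, zpow_zero, Units.val_one, map_one, mul_one, funext h]

theorem expH_single_last (k : ℤ) : expH (Pi.single (Fin.last n) k)
    = inr ((Uq.K ω ^ k : (Uq ω)ˣ) : Uq ω) := by
  rw [expH_succ, Pi.single_eq_same]
  have h : (fun i : Fin n => Pi.single (M := fun _ => ℤ) (Fin.last n) k i.castSucc) = 0 := by
    ext i
    rw [Pi.single_eq_of_ne (Fin.castSucc_lt_last i).ne, Pi.zero_apply]
  rw [h, expH_zero, map_one, one_mul]

theorem expH_add (m m' : Fin n → ℤ) :
    (expH (m + m') : BUqTensor ω n) = expH m * expH m' := by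
  induction n with
  | zero => exact (one_mul (1 : ℂ)).symm
  | succ n ih =>
    have h := ih (fun i => m i.castSucc) (fun i => m' i.castSucc)
    rw [expH_succ, expH_succ m, expH_succ m', mul_assoc, ← mul_assoc (inr _),
      inr_mul_inl_of_central (Uq.K_zpow_comm _), mul_assoc, ← mul_assoc, ← map_mul, ← map_mul,
      ← Units.val_mul, ← zpow_add, ← h]
    rfl

/-! ### The action of A† on the braided power is inner. -/

variable (ω n) in
/-- The element of the braided tensor product whose commutator is the action of `A†`. -/
def innerAd : BUqTensor ω n :=
  ∑ j, expH (Pi.single j (-1)) * expH (fun k => if j < k then -4 else 0) * place j (Uq.Ad ω)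

/-- The new place lies after every earlier j, so each old summand acquires K⁻⁴ there; the summand of
the new place itself is K⁻¹A†. -/
theorem innerAd_succ : innerAd ω (n + 1)
    = inl (innerAd ω n) * inr ((Uq.K ω ^ (-4 : ℤ) : (Uq ω)ˣ) : Uq ω)
      + inr (Uq.gen ω .Kinv * Uq.Ad ω) := by
  rw [innerAd, Fin.sum_univ_castSucc, innerAd, map_sum, Finset.sum_mul]
  refine congrArg₂ (· + ·) ?_ ?_
  · refine Finset.sum_congr rfl fun j _ => ?_
    rw [expH_eq_inl (m' := Pi.single j (-1)) (by intro i; simp [Pi.single_apply])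
      (Pi.single_eq_of_ne (Fin.castSucc_lt_last j).ne' _), expH_succ]
    simp only [Fin.castSucc_lt_castSucc_iff, Fin.castSucc_lt_last, if_true]
    rw [place_castSucc, mul_assoc, mul_assoc, inr_mul_inl_of_central (Uq.K_zpow_comm _),
      ← mul_assoc, ← mul_assoc, ← map_mul, ← map_mul]
  · have h : (fun k => if Fin.last n < k then -4 else 0) = (0 : Fin (n + 1) → ℤ) := by
      ext k
      simp [(Fin.le_last k).not_gt]
    rw [h, expH_zero, mul_one, expH_single_last, place_last, ← map_mul, Uq.K_zpow_neg_one]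

/-- The two claims support each other: a central exponential has zero commutator with Zₙ, so A†
kills it, and so it also commutes with the next factor. -/
theorem act_Ad_and_expH_comm (hω : ω ≠ 0) (n : ℕ) :
    (∀ c : BUqTensor ω n, (ModAlg.BUqPow ω n).act (Uq.Ad ω) c
        = innerAd ω n * c - c * innerAd ω n) ∧
      ∀ (m : Fin n → ℤ) (c : BUqTensor ω n), expH m * c = c * expH m := by
  induction n with
  | zero =>
    constructor
    · intro c
      have h : (ModAlg.BUqPow ω 0).act (Uq.Ad ω) c = Uq.counit ω (Uq.Ad ω) • c := rfl
      rw [h, Uq.counit_gen]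
      simp [Uq.counitGen, innerAd]
    · intro m c
      exact mul_comm (G := ℂ) _ c
  | succ n ih =>
    obtain ⟨hZ, hW⟩ := ih
    constructor
    · have hl : ∀ c : BUqTensor ω n, (ModAlg.BUqPow ω (n + 1)).act (Uq.Ad ω) (inl c)
          = innerAd ω (n + 1) * inl c - inl c * innerAd ω (n + 1) := by
        intro c
        have hK : inr (Uq.gen ω .Kinv) * inl (innerAd ω n * c - c * innerAd ω n)
            = inl (innerAd ω n * c - c * innerAd ω n) * inr (Uq.gen ω .Kinv) :=
          inr_mul_inl_of_central (x := Uq.gen ω .Kinv) Uq.Kinv_comm _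
        have hK' : inr (Uq.gen ω .Kinv) * inl c = inl c * inr (Uq.gen ω .Kinv) :=
          inr_mul_inl_of_central (x := Uq.gen ω .Kinv) Uq.Kinv_comm _
        -- The exchange rule for A† multiplied by K⁻¹: the error is [Zₙ,c] ωK⁻²[H].
        have e : (inr (Uq.gen ω .Kinv * Uq.Ad ω) * inl c : BUqTensor ω (n + 1))
            = inl c * inr (Uq.gen ω .Kinv * Uq.Ad ω)
              + inl (innerAd ω n * c - c * innerAd ω n)
                * inr (ω • (Uq.gen ω .Kinv * (Uq.gen ω .Kinv * Uq.brH ω))) := by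
          rw [map_mul inr, mul_assoc, inr_Ad_mul_inl, hZ, mul_add, ← mul_assoc, hK', mul_assoc,
            mul_smul_comm, ← mul_assoc (inr _) (inl _), hK, mul_assoc, ← map_mul inr, ← map_mul inr,
            map_smul inr, mul_smul_comm]
        -- The two parts of Zₙ₊₁ contribute [Zₙ,c]K⁻⁴ and [Zₙ,c] ωK⁻²[H], with sum [Zₙ,c].
        rw [act_Ad_inl, hZ, innerAd_succ, add_mul, mul_assoc,
          inr_mul_inl_of_central (Uq.K_zpow_comm _), e, mul_add, ← mul_assoc (inl (innerAd ω n)),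
          ← mul_assoc (inl c) (inl (innerAd ω n)),
          ← map_mul inl, ← map_mul inl, add_sub_add_comm, ← sub_mul, ← map_sub,
          add_sub_cancel_left, ← mul_add, ← map_add, Uq.K_zpow_add_smul hω, map_one, mul_one]
      have hr : ∀ x : Uq ω, (ModAlg.BUqPow ω (n + 1)).act (Uq.Ad ω) (inr x)
          = innerAd ω (n + 1) * inr x - inr x * innerAd ω (n + 1) := by
        intro x
        -- A† kills Zₙ, so Zₙ commutes with the last factor. Only the commutator with K⁻¹A†
        -- survives, and that is the adjoint action of A†.
        have hc : inr x * inl (innerAd ω n) = inl (innerAd ω n) * inr x :=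
          inr_mul_inl_of_act_Ad x (by rw [hZ, sub_self])
        rw [act_Ad_inr, innerAd_succ, add_mul, mul_add, ← mul_assoc (inr x), hc, mul_assoc,
          mul_assoc, ← map_mul, ← map_mul, ← map_mul, ← map_mul, Uq.K_zpow_comm,
          add_sub_add_left_eq_sub, ← map_sub, mul_sub, mul_assoc, ← mul_assoc x, Uq.gen_Kinv,
          ← Uq.Kinv_comm x, mul_assoc]
      intro u
      induction u using induction_succ with
      | h a b =>
        -- Both sides are derivations, so agreement on the two subalgebras suffices.
        rw [ModAlg.act_leibniz _ (ModAlg.tensorAct_Ad _ _), hl, hr]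
        noncomm_ring
      | hadd u v hu hv => rw [map_add, hu, hv]; noncomm_ring
    · intro m u
      have hl : ∀ c, Commute (expH m) (inl c : BUqTensor ω (n + 1)) := by
        intro c
        rw [expH_succ]
        refine Commute.mul_left ?_ (inr_mul_inl_of_central (Uq.K_zpow_comm _) c)
        rw [Commute, SemiconjBy, ← map_mul, ← map_mul, hW]
      have hr : ∀ x, Commute (expH m) (inr x : BUqTensor ω (n + 1)) := by
        intro x
        rw [expH_succ]
        refine Commute.mul_left (inr_mul_inl_of_act_Ad x ?_).symm ?_
        · rw [hZ, hW, sub_self]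
        · rw [Commute, SemiconjBy, ← map_mul, ← map_mul, Uq.K_zpow_comm]
      induction u using induction_succ with
      | h a b => exact (hl a).mul_right (hr b)
      | hadd u v hu hv => rw [mul_add, hu, hv, add_mul]

variable (ω n) in
/-- The central unit `e^{(ω/2) ∑ₖ H̄ₖ}`. -/
def expHUnit : (BUqTensor ω n)ˣ where
  val := expH fun _ => 2
  inv := expH fun _ => -2
  val_inv := by rw [← expH_add, ← expH_zero]; rfl
  inv_val := by rw [← expH_add, ← expH_zero]; rfl

theorem isInner (hω : ω ≠ 0) (n : ℕ) :
    ModAlg.IsInner (ModAlg.BUqPow ω n) (innerAd ω n) (expHUnit ω n) where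
  act_Ad := (act_Ad_and_expH_comm hω n).1
  comm := (act_Ad_and_expH_comm hω n).2 _

/-! ### X̄, X̄† and M̄ as images under the centralizing copies. -/

/-- The copy of `U_q(h)` in the braided tensor product that centralizes the first `n` factors. -/
def lastHom (hω : ω ≠ 0) : Uq ω →ₐ[ℂ] BUqTensor ω (n + 1) := (isInner hω n).toBTensor

theorem lastHom_A (hω : ω ≠ 0) :
    (lastHom hω (Uq.A ω) : BUqTensor ω (n + 1)) = inl (expH fun _ => -2) * inr (Uq.A ω) :=
  (isInner hω n).toBTensor_A

theorem lastHom_Ad (hω : ω ≠ 0) : (lastHom hω (Uq.Ad ω) : BUqTensor ω (n + 1))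
    = inl (expH fun _ => 2)
      * (inr (Uq.Ad ω) - ω • (inl (innerAd ω n) * inr (Uq.gen ω .Kinv * Uq.brH ω))) :=
  (isInner hω n).toBTensor_Ad

theorem lastHom_N (hω : ω ≠ 0) : (lastHom hω (Uq.N ω) : BUqTensor ω (n + 1))
    = inr (Uq.N ω) - ω • (inl (innerAd ω n) * inr (Uq.gen ω .Kinv * Uq.A ω)) :=
  (isInner hω n).toBTensor_N

theorem lastHom_H (hω : ω ≠ 0) : (lastHom hω (Uq.H ω) : BUqTensor ω (n + 1)) = inr (Uq.H ω) :=
  (isInner hω n).toBTensor_H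

theorem lastHom_K (hω : ω ≠ 0) :
    (lastHom hω (Uq.K ω : Uq ω) : BUqTensor ω (n + 1)) = inr (Uq.K ω : Uq ω) :=
  (isInner hω n).toBTensor_K

theorem inr_brH_mul (hω : ω ≠ 0) :
    (inr (Uq.brH ω) * (lastHom hω (Uq.N ω) - inr (Uq.N ω)) : BUqTensor ω (n + 1))
      = lastHom hω (Uq.Ad ω) * lastHom hω (Uq.A ω) - inr (Uq.Ad ω) * inr (Uq.A ω) :=
  (isInner hω n).inrUq_brH_mul

/-- The formulas of index i involve no place beyond i, so they are unaffected by appending a factor.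
The same holds for `Xd_castSucc` and `M_castSucc`. -/
theorem X_castSucc (i : Fin n) : X ω i.castSucc = inl (X ω i) := by
  rw [X, X, place_castSucc, map_mul]
  congr 1
  exact expH_eq_inl (by simp) (if_neg (Fin.le_last _).not_gt)

theorem X_last (hω : ω ≠ 0) : X ω (Fin.last n) = lastHom hω (Uq.A ω) := by
  rw [lastHom_A]
  rw [X, place_last]
  congr 1
  exact expH_eq_inl (fun i => if_pos (Fin.castSucc_lt_last i)) (if_neg (lt_irrefl _))

theorem sum_filter_lt_castSucc {V : Type*} [AddCommMonoid V] (f : Fin (n + 1) → V) (i : Fin n) :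
    ∑ j ∈ Finset.univ.filter (· < i.castSucc), f j
      = ∑ j ∈ Finset.univ.filter (· < i), f j.castSucc := by
  rw [Finset.sum_filter, Finset.sum_filter, Fin.sum_univ_castSucc, if_neg (Fin.le_last _).not_gt,
    add_zero]
  simp

theorem sum_filter_lt_last {V : Type*} [AddCommMonoid V] (f : Fin (n + 1) → V) :
    ∑ j ∈ Finset.univ.filter (· < Fin.last n), f j = ∑ j : Fin n, f j.castSucc := by
  rw [Finset.sum_filter, Fin.sum_univ_castSucc, if_neg (lt_irrefl _), add_zero]
  simp [Fin.castSucc_lt_last]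

theorem expH_single_castSucc (i : Fin n) (k : ℤ) :
    expH (Pi.single i.castSucc k) = inl (expH (ω := ω) (Pi.single i k)) :=
  expH_eq_inl (by intro j; simp [Pi.single_apply])
    (Pi.single_eq_of_ne (Fin.castSucc_lt_last i).ne' _)

theorem Xd_castSucc (i : Fin n) : Xd ω i.castSucc = inl (Xd ω i) := by
  rw [Xd, Xd, map_sub, map_smul, map_mul, map_mul, map_mul, map_sum, sum_filter_lt_castSucc,
    place_castSucc, place_castSucc, expH_single_castSucc]
  congr 3
  · exact expH_eq_inl (by simp) (if_neg (Fin.le_last _).not_gt)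
  · refine Finset.sum_congr rfl fun j _ => ?_
    rw [map_mul, map_mul, map_mul, place_castSucc, expH_single_castSucc]
    congr 3
    · exact expH_eq_inl (by simp) (if_neg (Fin.le_last _).not_gt)
    · exact expH_eq_inl (by simp) (if_neg fun h => (Fin.le_last _).not_gt h.2)

/-- Multiplication by W raises every exponent of K by 2: from 0 to 2 before place j, from -1 to 1 at
j, from -4 to -2 after j. This identifies the sum in X̄† as WZ. -/
theorem expH_two_mul_innerAd : expH (fun _ => 2) * innerAd ω n
    = ∑ j, expH (fun k => if k < j then 2 else 0) * expH (Pi.single j 1) *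
        expH (fun k => if j < k then -2 else 0) * place j (Uq.Ad ω) := by
  rw [innerAd, Finset.mul_sum]
  refine Finset.sum_congr rfl fun j _ => ?_
  rw [← mul_assoc, ← mul_assoc]
  congr 1
  simp only [← expH_add]
  congr 1
  ext k
  rcases lt_trichotomy k j with h | rfl | h
  · simp [h, h.not_gt, h.ne]
  · simp
  · simp [h, h.not_gt, h.ne']

theorem Xd_last (hω : ω ≠ 0) : Xd ω (Fin.last n) = lastHom hω (Uq.Ad ω) := by
  rw [lastHom_Ad]
  -- For the last index the bound k < i holds at every earlier place, and the exponent at the last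
  -- place is 0, so the sum lives in the first n factors.
  have hs : ∑ j ∈ Finset.univ.filter (· < Fin.last n),
      expH (fun k => if k < j then 2 else 0) * expH (Pi.single j 1) *
        expH (fun k => if j < k ∧ k < Fin.last n then -2 else 0) * place j (Uq.Ad ω)
      = inl (expH (fun _ => 2) * innerAd ω n) := by
    rw [sum_filter_lt_last, expH_two_mul_innerAd, map_sum]
    refine Finset.sum_congr rfl fun j _ => ?_
    rw [map_mul, map_mul, map_mul, place_castSucc, expH_single_castSucc]
    congr 3
    · exact expH_eq_inl (by simp) (if_neg (Fin.le_last _).not_gt)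
    · exact expH_eq_inl (by simp [Fin.castSucc_lt_last]) (if_neg fun h => lt_irrefl _ h.2)
  rw [Xd, hs, place_last, place_last, expH_single_last, Uq.K_zpow_neg_one, ← map_mul, Uq.brH_comm,
    inr_mul_inl_of_central Uq.Kinv_mul_brH_comm, map_mul inl, mul_sub, mul_smul_comm, mul_assoc]
  congr 2
  exact expH_eq_inl (fun i => if_pos (Fin.castSucc_lt_last i)) (if_neg (lt_irrefl _))

theorem M_castSucc (i : Fin n) : M ω i.castSucc = inl (M ω i) := by
  rw [M, M, map_sub, map_smul, map_mul, map_sum, sum_filter_lt_castSucc, place_castSucc,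
    place_castSucc, expH_single_castSucc]
  congr 3
  refine Finset.sum_congr rfl fun j _ => ?_
  rw [map_mul, map_mul, map_mul, place_castSucc, expH_single_castSucc]
  congr 3
  exact expH_eq_inl (by simp) (if_neg fun h => (Fin.le_last _).not_gt h.2)

theorem M_last (hω : ω ≠ 0) : M ω (Fin.last n) = lastHom hω (Uq.N ω) := by
  rw [lastHom_N]
  -- The exponents in M̄ are those of Zₙ itself, since N is corrected without scaling by W.
  have hs : ∑ j ∈ Finset.univ.filter (· < Fin.last n), expH (Pi.single j (-1)) *
        expH (fun k => if j < k ∧ k < Fin.last n then -4 else 0) * place j (Uq.Ad ω)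
          * place (Fin.last n) (Uq.A ω)
      = inl (innerAd ω n) * inr (Uq.A ω) := by
    rw [sum_filter_lt_last, innerAd, map_sum, Finset.sum_mul]
    refine Finset.sum_congr rfl fun j _ => ?_
    rw [map_mul, map_mul, place_castSucc, place_last, expH_single_castSucc]
    congr 3
    exact expH_eq_inl (by simp [Fin.castSucc_lt_last]) (if_neg fun h => lt_irrefl _ h.2)
  rw [M, hs, place_last, expH_single_last, Uq.K_zpow_neg_one, ← mul_assoc,
    inr_mul_inl_of_central (x := Uq.gen ω .Kinv) Uq.Kinv_comm, mul_assoc, ← map_mul]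

theorem brH_mul_M_sub (hω : ω ≠ 0) (i : Fin n) :
    place i (Uq.brH ω) * (M ω i - place i (Uq.N ω))
      = Xd ω i * X ω i - place i (Uq.Ad ω) * place i (Uq.A ω) := by
  induction n with
  | zero => exact i.elim0
  | succ n ih =>
    induction i using Fin.lastCases with
    | last =>
      rw [M_last hω, Xd_last hω, X_last hω]
      simp only [place_last]
      exact inr_brH_mul hω
    | cast i =>
      simp only [place_castSucc, M_castSucc, Xd_castSucc, X_castSucc, ← map_mul, ← map_sub, ih]

/-! ### The isomorphism with the ordinary tensor power. -/

/-- Splitting off the last factor of the braided tensor product as an ordinary tensor factor. -/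
def splitLast (hω : ω ≠ 0) (n : ℕ) : BUqTensor ω (n + 1) ≃ₐ[ℂ] BUqTensor ω n ⊗[ℂ] Uq ω :=
  (isInner hω n).equiv

theorem splitLast_inl (hω : ω ≠ 0) (c : BUqTensor ω n) : splitLast hω n (inl c) = c ⊗ₜ 1 :=
  (isInner hω n).equiv_inl c

theorem splitLast_lastHom (hω : ω ≠ 0) (x : Uq ω) :
    splitLast hω n (lastHom hω x) = 1 ⊗ₜ x :=
  (isInner hω n).equiv_toBTensor x

/-- The isomorphism from the braided to the ordinary tensor power. -/
def toPiTensor (hω : ω ≠ 0) : (n : ℕ) → BUqTensor ω n ≃ₐ[ℂ] (⨂[ℂ] _ : Fin n, Uq ω)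
  | 0 => (PiTensorProduct.isEmptyAlgEquiv ℂ (Uq ω)).symm
  | n + 1 => (splitLast hω n).trans
      ((Algebra.TensorProduct.congr (toPiTensor hω n) AlgEquiv.refl).trans
        (PiTensorProduct.snocAlgEquiv n))

theorem toPiTensor_inl_of_eq (hω : ω ≠ 0) {c : BUqTensor ω n} {i : Fin n} {x : Uq ω}
    (h : toPiTensor hω n c = PiTensorProduct.singleAlgHom i x) :
    toPiTensor hω (n + 1) (inl c) = PiTensorProduct.singleAlgHom i.castSucc x := by
  rw [toPiTensor, AlgEquiv.trans_apply, AlgEquiv.trans_apply, splitLast_inl,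
    Algebra.TensorProduct.congr_apply, Algebra.TensorProduct.map_tmul,
    ← PiTensorProduct.snocAlgEquiv_singleAlgHom_tmul_one]
  congr 2

theorem toPiTensor_lastHom (hω : ω ≠ 0) (x : Uq ω) :
    toPiTensor hω (n + 1) (lastHom hω x)
      = PiTensorProduct.singleAlgHom (Fin.last n) x := by
  rw [toPiTensor, AlgEquiv.trans_apply, AlgEquiv.trans_apply, splitLast_lastHom,
    Algebra.TensorProduct.congr_apply, Algebra.TensorProduct.map_tmul,
    ← PiTensorProduct.snocAlgEquiv_one_tmul]
  simp

/-- At the last index all five elements are values of `lastHom`, which `splitLast` carries to 1 ⊗ x;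
at smaller indices they lie in the first n factors, where the induction hypothesis applies. -/
theorem toPiTensor_spec (hω : ω ≠ 0) (i : Fin n) :
    toPiTensor hω n (X ω i) = PiTensorProduct.singleAlgHom i (Uq.A ω) ∧
    toPiTensor hω n (Xd ω i) = PiTensorProduct.singleAlgHom i (Uq.Ad ω) ∧
    toPiTensor hω n (place i (Uq.H ω)) = PiTensorProduct.singleAlgHom i (Uq.H ω) ∧
    toPiTensor hω n (place i (Uq.K ω : Uq ω)) = PiTensorProduct.singleAlgHom i (Uq.K ω : Uq ω) ∧
    toPiTensor hω n (M ω i) = PiTensorProduct.singleAlgHom i (Uq.N ω) := by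
  induction n with
  | zero => exact i.elim0
  | succ n ih =>
    induction i using Fin.lastCases with
    | last =>
      rw [M_last hω, Xd_last hω, X_last hω, place_last, place_last]
      refine ⟨toPiTensor_lastHom hω _, toPiTensor_lastHom hω _, ?_, ?_,
        toPiTensor_lastHom hω _⟩
      · rw [← toPiTensor_lastHom hω, lastHom_H]
      · rw [← toPiTensor_lastHom hω, lastHom_K]
    | cast i =>
      obtain ⟨h₁, h₂, h₃, h₄, h₅⟩ := ih i
      rw [M_castSucc, Xd_castSucc, X_castSucc, place_castSucc, place_castSucc]
      exact ⟨toPiTensor_inl_of_eq hω h₁, toPiTensor_inl_of_eq hω h₂, toPiTensor_inl_of_eq hω h₃,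
        toPiTensor_inl_of_eq hω h₄, toPiTensor_inl_of_eq hω h₅⟩

end BUqTensor

end BraidedHeisenberg

end

open BraidedHeisenberg in
theorem theorem5p1 (ω : ℂ) (hω : ω ≠ 0) (n : ℕ) :
    (∀ i : Fin n,
      BUqTensor.place i (Uq.brH ω) * (BUqTensor.M ω i - BUqTensor.place i (Uq.N ω))
        = BUqTensor.Xd ω i * BUqTensor.X ω i
          - BUqTensor.place i (Uq.Ad ω) * BUqTensor.place i (Uq.A ω)) ∧
    ∃! φ : BUqTensor ω n ≃ₐ[ℂ] (⨂[ℂ] _ : Fin n, Uq ω),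
      ∀ i : Fin n,
        φ (BUqTensor.X ω i) = PiTensorProduct.singleAlgHom i (Uq.A ω) ∧
        φ (BUqTensor.Xd ω i) = PiTensorProduct.singleAlgHom i (Uq.Ad ω) ∧
        φ (BUqTensor.place i (Uq.H ω)) = PiTensorProduct.singleAlgHom i (Uq.H ω) ∧
        φ (BUqTensor.place i (Uq.K ω : Uq ω)) =
          PiTensorProduct.singleAlgHom i (Uq.K ω : Uq ω) ∧
        φ (BUqTensor.M ω i) = PiTensorProduct.singleAlgHom i (Uq.N ω) := by
  refine ⟨BUqTensor.brH_mul_M_sub hω, BUqTensor.toPiTensor hω n, BUqTensor.toPiTensor_spec hω,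
    fun φ hφ => ?_⟩
  -- The inverses are compared because a homomorphism out of the ordinary tensor power is determined
  -- by its factors, and on each factor by the generators of U_q(h). No generating set of the
  -- braided power has to be exhibited.
  have key : (φ.symm : (⨂[ℂ] _ : Fin n, Uq ω) →ₐ[ℂ] BUqTensor ω n)
      = (BUqTensor.toPiTensor hω n).symm := by
    refine PiTensorProduct.algHom_ext fun i => ?_
    obtain ⟨h₁, h₂, h₃, h₄, h₅⟩ := hφ i
    obtain ⟨g₁, g₂, g₃, g₄, g₅⟩ := BUqTensor.toPiTensor_spec hω i
    have e : ∀ {u : BUqTensor ω n} {x : Uq ω}, φ u = PiTensorProduct.singleAlgHom i x →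
        BUqTensor.toPiTensor hω n u = PiTensorProduct.singleAlgHom i x →
        φ.symm (PiTensorProduct.singleAlgHom i x)
          = (BUqTensor.toPiTensor hω n).symm (PiTensorProduct.singleAlgHom i x) := by
      intro u x h g
      rw [← h, φ.symm_apply_apply, h, ← g, AlgEquiv.symm_apply_apply]
    exact Uq.algHom_ext (e h₁ g₁) (e h₂ g₂) (e h₅ g₅) (e h₃ g₃) (e h₄ g₄)
  have key' : φ.symm = (BUqTensor.toPiTensor hω n).symm :=
    AlgEquiv.ext fun x => DFunLike.congr_fun key x
  rw [← φ.symm_symm, key', AlgEquiv.symm_symm]
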